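/- Let $d\in\mathbb{N}$, let $\mathcal{A}$ be a finite non-empty set, and let $\Phi=\{\phi_a\}_{a\in\mathcal{A}}$ be an iterated function system on $\mathbb{R}^d$ (with the Euclidean norm) of the form $$\phi_a(x)=\frac{x+\mathfrak{p}_a}{q_a},\qquad \mathfrak{p}_a\in\mathbb{Z}^d,\ q_a\in\mathbb{Z},\ |q_a|\ge 2 ,$$ with no separation assumption. Let $r_a=1/|q_a|$ be the contraction ratio of $\phi_a$. For a finite word $\mathbf{a}=(a_1,\ldots,a_n)\in\mathcal{A}^n$ put $|\mathbf{a}|=n$ and $\phi_{\mathbf{a}}=\phi_{a_1}\circ\cdots\circ\phi_{a_n}$. Let $\pi:\mathcal{A}^{\mathbb{N}}\to\mathbb{R}^d$, $\pi((a_n))=\lim_{n\to\infty}(\phi_{a_1}\circ\cdots\circ\phi_{a_n})(0)$, let $X=\pi(\mathcal{A}^{\mathbb{N}})$ be the self-similar set of $\Phi$, i.e. the unique non-empty compact set with $X=\bigcup_{a}\phi_a(X)$, and let $X_{\mathbf{a}}=\phi_{\mathbf{a}}(X)$. Let $\dim_S(\Phi)$ be the unique $s$ with $\sum_{a}r_a^s=1$,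 let $\mathbf{p}=(p_a)_{a\in\mathcal{A}}$ with $p_a=r_a^{\dim_S(\Phi)}$, let $h_{\mathbf{p}}=-\sum_a p_a\log p_a$, and let $\mu$ be the self-similar measure of $\Phi$ and $\mathbf{p}$, i.e. the unique Borel probability measure with $\mu=\sum_a p_a\,\phi_a\mu$; equivalently, the image under $\pi$ of the Bernoulli measure on $\mathcal{A}^{\mathbb{N}}$ with weights $\mathbf{p}$. Let $g:\mathbb{N}\to[0,\infty)$, where $\mathbb{N}=\{1,2,\ldots\}$. For $\mathfrak{p}/q\in X\cap\mathbb{Q}^d$ let $$\Psi_g(\mathfrak{p}/q)=\sup\Big\{\mathrm{Diam}(X_{\mathbf{a}})\,g(|\mathbf{a}|):\ \mathbf{a}\in\bigcup_{n\ge1}\mathcal{A}^n,\ 0\le l\le|\mathbf{a}|-1,\ \mathfrak{p}/q=\pi\big(a_1\ldots a_l(a_{l+1}\ldots a_{|\mathbf{a}|})^{\infty}\big)\Big\}\in[0,\infty]$$ (the supremum is a maximum whenever a maximum exists), and let $$W_\Phi^{**}(g)=\{x\in X:\ \|x-\mathfrak{p}/q\|<\Psi_g(\mathfrak{p}/q)\text{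 for infinitely many points }\mathfrak{p}/q\in X\cap\mathbb{Q}^d\}.$$ Then, with the convention $0^0=1$, the following statements are true. 1. For any $s\ge0$, if $\displaystyle\sum_{n=1}^{\infty}\sum_{\mathbf{a}\in\mathcal{A}^n}n\,\big(\mathrm{Diam}(X_{\mathbf{a}})\,g(n)\big)^{s}<\infty$, then $\mathcal{H}^s(W_\Phi^{**}(g))=0$, where $\mathcal{H}^s$ is $s$-dimensional Hausdorff measure. 2. If $g$ is non-increasing, $h_{\mathbf{p}}<-2\log\sum_{a\in\mathcal{A}}p_a^2$, and $\displaystyle\sum_{n=1}^{\infty}\sum_{\mathbf{a}\in\mathcal{A}^n}n\,\big(\mathrm{Diam}(X_{\mathbf{a}})\,g(n)\big)^{\dim_S(\Phi)}=\infty$, then $\mu(W_\Phi^{**}(g))=1$. -/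

import Mathlib

open Set Filter Topology MeasureTheory
open scoped NNReal ENNReal

/-- An iterated function system on `ℝ^d` (with the Euclidean norm), indexed by the alphabet `A`,
of the form `φ_a(x) = (x + 𝔭_a) / q_a` with `𝔭_a ∈ ℤ^d`, `q_a ∈ ℤ` and `|q_a| ≥ 2`. -/
structure RationalIFS (d : ℕ) (A : Type*) where
  /-- the translation vectors `𝔭_a` -/
  num : A → Fin d → ℤ
  /-- the denominators `q_a` -/
  den : A → ℤ
  two_le_abs_den : ∀ a, 2 ≤ |den a|

namespace RationalIFS

noncomputable section

variable {d : ℕ} {A : Type*}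

/-- The similarity `φ_a(x) = (x + 𝔭_a) / q_a`. -/
def map (Φ : RationalIFS d A) (a : A) (x : EuclideanSpace ℝ (Fin d)) : EuclideanSpace ℝ (Fin d) :=
  ((Φ.den a : ℝ))⁻¹ • (x + WithLp.toLp 2 (fun i => (Φ.num a i : ℝ)))

/-- The contraction ratio `r_a = 1 / |q_a|` of `φ_a`. -/
def ratio (Φ : RationalIFS d A) (a : A) : ℝ := |(Φ.den a : ℝ)|⁻¹

/-- `φ_𝐚 = φ_{a_1} ∘ ⋯ ∘ φ_{a_n}` for a finite word `𝐚 = (a_1, …, a_n)`. -/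
def wordMap (Φ : RationalIFS d A) {n : ℕ} (a : Fin n → A) (x : EuclideanSpace ℝ (Fin d)) :
    EuclideanSpace ℝ (Fin d) :=
  (List.ofFn a).foldr Φ.map x

/-- The projection `π(ω) = lim_n (φ_{ω_1} ∘ ⋯ ∘ φ_{ω_n})(0)`; the sequence `ω` is indexed from `0`.
The limit exists, see `tendsto_proj`. -/
def proj (Φ : RationalIFS d A) (ω : ℕ → A) : EuclideanSpace ℝ (Fin d) :=
  limUnder atTop fun n : ℕ => Φ.wordMap (fun i : Fin n => ω i) 0

/-- The self-similar set `X = π(A^ℕ)`. By `selfSimilarSet_spec` and `selfSimilarSet_unique` it is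
the unique non-empty compact set with `X = ⋃_a φ_a(X)`. -/
def selfSimilarSet (Φ : RationalIFS d A) : Set (EuclideanSpace ℝ (Fin d)) := range Φ.proj

/-- `Diam(X_𝐚)`, the diameter of `X_𝐚 = φ_𝐚(X)`. -/
def cylDiam (Φ : RationalIFS d A) {n : ℕ} (a : Fin n → A) : ℝ≥0∞ :=
  Metric.ediam (Φ.wordMap a '' Φ.selfSimilarSet)

/-- The similarity dimension `dim_S(Φ)`: the only element of `{s | ∑_a r_a ^ s = 1}`, see
`simDim_spec` and `simDim_unique`. -/
def simDim [Fintype A] (Φ : RationalIFS d A) : ℝ := sInf {s : ℝ | ∑ a, Φ.ratio a ^ s = 1}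

/-- The probability vector `p_a = r_a ^ dim_S(Φ)`. -/
def prob [Fintype A] (Φ : RationalIFS d A) (a : A) : ℝ := Φ.ratio a ^ Φ.simDim

/-- The entropy `h_𝐩 = -∑_a p_a log p_a`. -/
def entropy [Fintype A] (Φ : RationalIFS d A) : ℝ := -∑ a, Φ.prob a * Real.log (Φ.prob a)

/-- The Bernoulli measure on `A^ℕ` with weights `(p_a)`. -/
def bernoulli [Fintype A] [MeasurableSpace A] (Φ : RationalIFS d A) : Measure (ℕ → A) :=
  Measure.infinitePi fun _ : ℕ => ∑ a, ENNReal.ofReal (Φ.prob a) • Measure.dirac a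

/-- The self-similar measure `μ`, the image of the Bernoulli measure under `π`. By
`selfSimilarMeasure_spec` and `selfSimilarMeasure_unique` it is the unique Borel probability
measure with `μ = ∑_a p_a • φ_a μ`. -/
def selfSimilarMeasure [Fintype A] [MeasurableSpace A] (Φ : RationalIFS d A) :
    Measure (EuclideanSpace ℝ (Fin d)) :=
  Φ.bernoulli.map Φ.proj

end

end RationalIFS

/-- The sequence `a_1 … a_l (a_{l+1} … a_n)^∞`, for `0 ≤ l ≤ n - 1`. -/
def eventuallyPeriodic {A : Type*} {n : ℕ} (a : Fin n → A) (l : Fin n) (k : ℕ) : A :=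
  if h : k < n then a ⟨k, h⟩ else
    a ⟨l + (k - l) % (n - l), by
      have := Nat.mod_lt (k - l) (Nat.sub_pos_of_lt l.isLt)
      omega⟩

/-- The points of `ℝ^d` with all coordinates rational. -/
def IsRationalPoint {d : ℕ} (y : EuclideanSpace ℝ (Fin d)) : Prop := ∀ i, ∃ c : ℚ, y i = c

/-- The sequence `a ω_1 ω_2 …`. -/
def consSeq {A : Type*} (a : A) (ω : ℕ → A) : ℕ → A
  | 0 => a
  | k + 1 => ω k

theorem measurable_consSeq {A : Type*} [MeasurableSpace A] (a : A) : Measurable (consSeq a) := by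
  refine measurable_pi_lambda _ fun k => ?_
  cases k with
  | zero => exact measurable_const
  | succ k => exact measurable_pi_apply k

namespace RationalIFS

noncomputable section

variable {d : ℕ} {A : Type*}

/-- `Ψ_g(y)`: the supremum of `Diam(X_𝐚) g(|𝐚|)` over all finite non-empty words `𝐚` and all
`0 ≤ l ≤ |𝐚| - 1` with `y = π(a_1 … a_l (a_{l+1} … a_{|𝐚|})^∞)`. The supremum is taken in
`[0, ∞]`; it is the maximum whenever a maximum exists. -/
def approxRadius (Φ : RationalIFS d A) (g : ℕ → ℝ≥0) (y : EuclideanSpace ℝ (Fin d)) : ℝ≥0∞ :=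
  ⨆ (n : ℕ) (a : Fin n → A) (l : Fin n) (_ : Φ.proj (eventuallyPeriodic a l) = y),
    Φ.cylDiam a * (g n : ℝ≥0∞)

/-- `W**(g)`: the points `x ∈ X` such that `‖x - y‖ < Ψ_g(y)` for infinitely many rational points
`y ∈ X`. -/
def wellApproximable (Φ : RationalIFS d A) (g : ℕ → ℝ≥0) : Set (EuclideanSpace ℝ (Fin d)) :=
  {x ∈ Φ.selfSimilarSet |
    {y ∈ Φ.selfSimilarSet | IsRationalPoint y ∧ edist x y < Φ.approxRadius g y}.Infinite}

/-- The sum `∑_{n ≥ 1} ∑_{𝐚 ∈ A^n} n (Diam(X_𝐚) g(n))^s ∈ [0, ∞]`. -/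
def volumeSum [Fintype A] (Φ : RationalIFS d A) (g : ℕ → ℝ≥0) (s : ℝ) : ℝ≥0∞ :=
  ∑' n : {n : ℕ // 1 ≤ n}, ∑ a : Fin n → A, ((n : ℕ) : ℝ≥0∞) * (Φ.cylDiam a * (g n : ℝ≥0∞)) ^ s

/-! The remaining facts confirm that the notions above are the standard ones. -/

theorem one_lt_abs_den (Φ : RationalIFS d A) (a : A) : (1 : ℝ) < |(Φ.den a : ℝ)| := by
  have h : (2 : ℝ) ≤ |(Φ.den a : ℝ)| := by exact_mod_cast Φ.two_le_abs_den a
  linarith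

theorem ratio_pos (Φ : RationalIFS d A) (a : A) : 0 < Φ.ratio a :=
  inv_pos.2 (zero_lt_one.trans (Φ.one_lt_abs_den a))

theorem ratio_le_half (Φ : RationalIFS d A) (a : A) : Φ.ratio a ≤ 1 / 2 := by
  have h : (2 : ℝ) ≤ |(Φ.den a : ℝ)| := by exact_mod_cast Φ.two_le_abs_den a
  unfold ratio
  rw [one_div]
  exact inv_anti₀ (by norm_num) h

/-- `φ_a` is a similarity with contraction ratio `r_a`. -/
theorem dist_map (Φ : RationalIFS d A) (a : A) (x y : EuclideanSpace ℝ (Fin d)) :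
    dist (Φ.map a x) (Φ.map a y) = Φ.ratio a * dist x y := by
  simp [map, ratio, dist_smul₀]

theorem continuous_map (Φ : RationalIFS d A) (a : A) : Continuous (Φ.map a) := by
  unfold map; fun_prop

theorem prob_pos [Fintype A] (Φ : RationalIFS d A) (a : A) : 0 < Φ.prob a :=
  Real.rpow_pos_of_pos (Φ.ratio_pos a) _

section Dimension

variable [Fintype A] [Nonempty A]

theorem strictAnti_sum (Φ : RationalIFS d A) : StrictAnti fun s : ℝ => ∑ a, Φ.ratio a ^ s := by
  intro s t hst
  refine Finset.sum_lt_sum_of_nonempty Finset.univ_nonempty fun a _ => ?_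
  exact Real.rpow_lt_rpow_of_exponent_gt (Φ.ratio_pos a)
    ((Φ.ratio_le_half a).trans_lt (by norm_num)) hst

theorem exists_dim (Φ : RationalIFS d A) : ∃ s : ℝ, ∑ a, Φ.ratio a ^ s = 1 := by
  have hc : Continuous fun s : ℝ => ∑ a, Φ.ratio a ^ s :=
    continuous_finsetSum _ fun a _ => Real.continuous_const_rpow (Φ.ratio_pos a).ne'
  have ht : Tendsto (fun s : ℝ => ∑ a, Φ.ratio a ^ s) atTop (𝓝 0) := by
    have h := tendsto_finsetSum (Finset.univ : Finset A) (f := fun a (s : ℝ) => Φ.ratio a ^ s)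
      (x := atTop) (a := fun _ => (0 : ℝ)) fun a _ => tendsto_rpow_atTop_of_base_lt_one _
        (by linarith [Φ.ratio_pos a]) ((Φ.ratio_le_half a).trans_lt (by norm_num))
    simpa using h
  obtain ⟨t, ht1, ht0⟩ := ((ht.eventually (gt_mem_nhds one_pos)).and (eventually_ge_atTop 0)).exists
  have h0 : (1 : ℝ) ≤ ∑ a, Φ.ratio a ^ (0 : ℝ) := by
    simp only [Real.rpow_zero, Finset.sum_const, nsmul_eq_mul, mul_one]
    exact_mod_cast Finset.card_pos.2 (Finset.univ_nonempty (α := A))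
  obtain ⟨s, -, hs⟩ := intermediate_value_Icc' ht0 hc.continuousOn ⟨ht1.le, h0⟩
  exact ⟨s, hs⟩

theorem simDim_unique (Φ : RationalIFS d A) {s : ℝ} (hs : ∑ a, Φ.ratio a ^ s = 1) :
    s = Φ.simDim := by
  have : {t : ℝ | ∑ a, Φ.ratio a ^ t = 1} = {s} := by
    ext t
    exact ⟨fun ht => Φ.strictAnti_sum.injective (ht.trans hs.symm), fun ht => by
      rw [mem_singleton_iff.1 ht]; exact hs⟩
  rw [simDim, this, csInf_singleton]

theorem simDim_spec (Φ : RationalIFS d A) : ∑ a, Φ.ratio a ^ Φ.simDim = 1 := by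
  obtain ⟨s, hs⟩ := Φ.exists_dim
  rwa [← Φ.simDim_unique hs]

theorem sum_ofReal_prob (Φ : RationalIFS d A) : ∑ a, ENNReal.ofReal (Φ.prob a) = 1 := by
  rw [← ENNReal.ofReal_sum_of_nonneg fun a _ => (Φ.prob_pos a).le]
  simp [prob, Φ.simDim_spec]

end Dimension

theorem dist_wordMap_le (Φ : RationalIFS d A) {n : ℕ} (a : Fin n → A)
    (x y : EuclideanSpace ℝ (Fin d)) :
    dist (Φ.wordMap a x) (Φ.wordMap a y) ≤ (1 / 2) ^ n * dist x y := by
  induction n with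
  | zero => simp [wordMap]
  | succ n ih =>
    have h := ih (fun i => a i.succ)
    simp only [wordMap, List.ofFn_succ, List.foldr_cons] at h ⊢
    rw [dist_map, pow_succ', mul_assoc]
    exact mul_le_mul (Φ.ratio_le_half _) h dist_nonneg (by norm_num)

theorem wordMap_cons (Φ : RationalIFS d A) (n : ℕ) (ω : ℕ → A) (x : EuclideanSpace ℝ (Fin d)) :
    Φ.wordMap (fun i : Fin (n + 1) => ω i) x =
      Φ.map (ω 0) (Φ.wordMap (fun i : Fin n => ω (i + 1)) x) := by
  simp [wordMap, List.ofFn_succ]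

theorem wordMap_snoc (Φ : RationalIFS d A) (n : ℕ) (ω : ℕ → A) (x : EuclideanSpace ℝ (Fin d)) :
    Φ.wordMap (fun i : Fin (n + 1) => ω i) x = Φ.wordMap (fun i : Fin n => ω i) (Φ.map (ω n) x) := by
  simp only [wordMap]
  rw [List.ofFn_succ']
  simp

theorem tendsto_proj [Finite A] (Φ : RationalIFS d A) (ω : ℕ → A) :
    Tendsto (fun n : ℕ => Φ.wordMap (fun i : Fin n => ω i) 0) atTop (𝓝 (Φ.proj ω)) := by
  obtain ⟨C, hC⟩ := (Set.finite_range fun a => dist 0 (Φ.map a 0)).bddAbove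
  refine (cauchySeq_of_le_geometric (1 / 2) C (by norm_num) fun n => ?_).tendsto_limUnder
  rw [wordMap_snoc, mul_comm]
  exact (Φ.dist_wordMap_le _ _ _).trans
    (mul_le_mul_of_nonneg_left (hC ⟨ω n, rfl⟩) (by positivity))

theorem tendsto_proj' [Finite A] (Φ : RationalIFS d A) (ω : ℕ → A)
    {x : ℕ → EuclideanSpace ℝ (Fin d)} {C : ℝ} (hx : ∀ n, dist (x n) 0 ≤ C) :
    Tendsto (fun n : ℕ => Φ.wordMap (fun i : Fin n => ω i) (x n)) atTop (𝓝 (Φ.proj ω)) := by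
  refine (tendsto_iff_of_dist ?_).2 (Φ.tendsto_proj ω)
  have h : Tendsto (fun n : ℕ => (1 / 2 : ℝ) ^ n * C) atTop (𝓝 0) := by
    simpa using (tendsto_pow_atTop_nhds_zero_of_lt_one (r := (1 / 2 : ℝ)) (by norm_num)
      (by norm_num)).mul_const C
  exact squeeze_zero (fun _ => dist_nonneg) (fun n => (Φ.dist_wordMap_le _ _ _).trans
    (mul_le_mul_of_nonneg_left (hx n) (by positivity))) h

theorem proj_eq_map (Φ : RationalIFS d A) [Finite A] (ω : ℕ → A) :
    Φ.proj ω = Φ.map (ω 0) (Φ.proj fun k => ω (k + 1)) := by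
  have h1 := (tendsto_add_atTop_iff_nat 1).2 (Φ.tendsto_proj ω)
  have h2 := ((Φ.continuous_map (ω 0)).tendsto _).comp (Φ.tendsto_proj fun k => ω (k + 1))
  refine tendsto_nhds_unique h1 (h2.congr fun n => ?_)
  exact (Φ.wordMap_cons n ω 0).symm

theorem selfSimilarSet_subset [Finite A] (Φ : RationalIFS d A)
    {K : Set (EuclideanSpace ℝ (Fin d))} (hne : K.Nonempty) (hcl : IsClosed K)
    (hK : ∀ a, MapsTo (Φ.map a) K K) : Φ.selfSimilarSet ⊆ K := by
  rintro _ ⟨ω, rfl⟩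
  obtain ⟨x, hx⟩ := hne
  refine hcl.mem_of_tendsto (Φ.tendsto_proj' ω (x := fun _ => x) fun _ => le_rfl)
    (Eventually.of_forall fun n => ?_)
  induction n generalizing ω with
  | zero => simpa [wordMap] using hx
  | succ n ih => rw [wordMap_cons]; exact hK _ (ih fun k => ω (k + 1))

theorem subset_selfSimilarSet [Finite A] (Φ : RationalIFS d A)
    {K : Set (EuclideanSpace ℝ (Fin d))} (hb : Bornology.IsBounded K)
    (hK : K ⊆ ⋃ a, Φ.map a '' K) : K ⊆ Φ.selfSimilarSet := by
  intro x hx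
  have h : ∀ z : K, ∃ (a : A) (w : K), Φ.map a w = z := fun z => by
    obtain ⟨a, w, hw, hz⟩ := mem_iUnion.1 (hK z.2)
    exact ⟨a, ⟨w, hw⟩, hz⟩
  choose f t hft using h
  obtain ⟨C, hC⟩ := hb.subset_closedBall 0
  let z : ℕ → K := fun n => t^[n] ⟨x, hx⟩
  have hz : ∀ n, Φ.wordMap (fun i : Fin n => f (z i)) (z n) = x := by
    intro n
    induction n with
    | zero => simp [wordMap, z]
    | succ n ih =>
      rw [Φ.wordMap_snoc n (fun k => f (z k))]
      have : ((z (n + 1) : K) : EuclideanSpace ℝ (Fin d)) = t (z n) := by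
        simp only [z, Function.iterate_succ_apply']
      rw [this, hft, ih]
  refine ⟨fun k => f (z k), tendsto_nhds_unique
    (Φ.tendsto_proj' (fun k => f (z k)) (x := fun n => z n) fun n => hC (z n).2) ?_⟩
  simp only [hz]
  exact tendsto_const_nhds

/-- Hutchinson: `X` is a non-empty compact set with `X = ⋃_a φ_a(X)`. -/
theorem selfSimilarSet_spec [Finite A] [Nonempty A] (Φ : RationalIFS d A) :
    Φ.selfSimilarSet.Nonempty ∧ IsCompact Φ.selfSimilarSet ∧
      Φ.selfSimilarSet = ⋃ a, Φ.map a '' Φ.selfSimilarSet := by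
  refine ⟨range_nonempty _, ?_, ?_⟩
  · let _ : TopologicalSpace A := ⊥
    have : DiscreteTopology A := ⟨rfl⟩
    refine isCompact_range ?_
    obtain ⟨C, hC⟩ := (Set.finite_range fun a => dist 0 (Φ.map a 0)).bddAbove
    have hu : TendstoUniformly (fun (n : ℕ) (ω : ℕ → A) => Φ.wordMap (fun i : Fin n => ω i) 0)
        Φ.proj atTop := by
      rw [Metric.tendstoUniformly_iff]
      intro ε hε
      have h0 : Tendsto (fun n : ℕ => C * (1 / 2 : ℝ) ^ n / (1 - 1 / 2)) atTop (𝓝 0) := by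
        simpa using ((tendsto_pow_atTop_nhds_zero_of_lt_one (r := (1 / 2 : ℝ)) (by norm_num)
          (by norm_num)).const_mul C).div_const (1 - 1 / 2)
      filter_upwards [h0.eventually (gt_mem_nhds hε)] with n hn ω
      rw [dist_comm]
      refine (dist_le_of_le_geometric_of_tendsto (1 / 2) C (by norm_num) (fun k => ?_)
        (Φ.tendsto_proj ω) n).trans_lt hn
      rw [wordMap_snoc, mul_comm]
      exact (Φ.dist_wordMap_le _ _ _).trans
        (mul_le_mul_of_nonneg_left (hC ⟨ω k, rfl⟩) (by positivity))
    refine hu.continuous (Eventually.of_forall fun n => ?_).frequently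
    exact continuous_of_discreteTopology.comp
      (f := fun (ω : ℕ → A) (i : Fin n) => ω i)
      (g := fun a : Fin n → A => Φ.wordMap a 0) (by fun_prop)
  · apply Subset.antisymm
    · rintro _ ⟨ω, rfl⟩
      exact mem_iUnion.2 ⟨ω 0, _, ⟨fun k => ω (k + 1), rfl⟩, (Φ.proj_eq_map ω).symm⟩
    · refine iUnion_subset fun a => ?_
      rintro _ ⟨_, ⟨ω, rfl⟩, rfl⟩
      exact ⟨consSeq a ω, Φ.proj_eq_map _⟩

theorem selfSimilarSet_unique [Finite A] (Φ : RationalIFS d A)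
    {K : Set (EuclideanSpace ℝ (Fin d))} (hne : K.Nonempty) (hc : IsCompact K)
    (hK : K = ⋃ a, Φ.map a '' K) : K = Φ.selfSimilarSet := by
  refine Subset.antisymm (Φ.subset_selfSimilarSet hc.isBounded hK.subset)
    (Φ.selfSimilarSet_subset hne hc.isClosed fun a x hx => ?_)
  rw [hK]
  exact mem_iUnion.2 ⟨a, x, hx, rfl⟩

section Measure

variable [Fintype A] [MeasurableSpace A] [DiscreteMeasurableSpace A]

theorem measurable_wordMap (Φ : RationalIFS d A) (n : ℕ) :
    Measurable fun z : (ℕ → A) × EuclideanSpace ℝ (Fin d) =>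
      Φ.wordMap (fun i : Fin n => z.1 i) z.2 := by
  have h : Measurable fun z : (Fin n → A) × EuclideanSpace ℝ (Fin d) => Φ.wordMap z.1 z.2 := by
    refine measurable_from_prod_countable_right fun a => Continuous.measurable ?_
    refine (LipschitzWith.of_dist_le_mul (K := (1 / 2) ^ n) fun x y => ?_).continuous
    simpa using Φ.dist_wordMap_le a x y
  exact h.comp (f := fun z : (ℕ → A) × EuclideanSpace ℝ (Fin d) =>
    ((fun i : Fin n => z.1 i), z.2)) (by fun_prop)

theorem measurable_proj (Φ : RationalIFS d A) : Measurable Φ.proj :=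
  measurable_of_tendsto_metrizable
    (f := fun (n : ℕ) (ω : ℕ → A) => Φ.wordMap (fun i : Fin n => ω i) 0)
    (fun n => (Φ.measurable_wordMap n).comp
      (measurable_id.prodMk (measurable_const (a := (0 : EuclideanSpace ℝ (Fin d))))))
    (tendsto_pi_nhds.2 Φ.tendsto_proj)

variable [Nonempty A]

instance (Φ : RationalIFS d A) :
    IsProbabilityMeasure (∑ a, ENNReal.ofReal (Φ.prob a) • Measure.dirac a : Measure A) :=
  ⟨by simp [Φ.sum_ofReal_prob]⟩

instance (Φ : RationalIFS d A) : IsProbabilityMeasure Φ.bernoulli := by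
  unfold bernoulli; infer_instance

theorem bernoulli_eq (Φ : RationalIFS d A) :
    Φ.bernoulli = ∑ a, ENNReal.ofReal (Φ.prob a) • Φ.bernoulli.map (consSeq a) := by
  classical
  symm
  refine Measure.eq_infinitePi _ fun s t ht => ?_
  obtain ⟨N, hN⟩ := s.exists_nat_subset_range
  let u : ℕ → Set A := fun i => if i ∈ s then t i else univ
  have hu : ∀ i, MeasurableSet (u i) := fun i => MeasurableSet.of_discrete
  have hs : Set.pi (s : Set ℕ) t = Set.pi (Finset.range (N + 1) : Set ℕ) u := by
    ext ω
    simp only [Set.mem_pi, u, Finset.mem_coe]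
    refine ⟨fun h i _ => ?_, fun h i hi => ?_⟩
    · split_ifs with hi
      · exact h i hi
      · trivial
    · simpa [hi] using h i (Finset.range_mono (Nat.le_succ N) (hN hi))
  have hp : ∏ i ∈ s, (∑ a, ENNReal.ofReal (Φ.prob a) • Measure.dirac a : Measure A) (t i) =
      ∏ i ∈ Finset.range (N + 1),
        (∑ a, ENNReal.ofReal (Φ.prob a) • Measure.dirac a : Measure A) (u i) := by
    refine (Finset.prod_congr rfl fun i hi => ?_).trans
      (Finset.prod_subset (hN.trans (Finset.range_mono (Nat.le_succ N))) fun i _ hi => ?_)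
    · simp [u, hi]
    · simp only [u, hi, if_false]
      exact measure_univ
  rw [hs, hp, Finset.prod_range_succ', Measure.finsetSum_apply]
  have hpre : ∀ a, consSeq a ⁻¹' Set.pi (Finset.range (N + 1) : Set ℕ) u =
      if a ∈ u 0 then Set.pi (Finset.range N : Set ℕ) (fun i => u (i + 1)) else ∅ := by
    intro a
    ext ω
    split_ifs with ha
    · simp only [mem_preimage, Set.mem_pi, Finset.mem_coe, Finset.mem_range]
      refine ⟨fun h i hi => h (i + 1) (by omega), fun h i hi => ?_⟩
      cases i with
      | zero => exact ha
      | succ i => exact h i (by omega)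
    · simp only [mem_preimage, Set.mem_pi, Finset.mem_coe, Finset.mem_range, mem_empty_iff_false,
        iff_false]
      exact fun h => ha (h 0 (by omega))
  have hm : MeasurableSet (Set.pi (Finset.range (N + 1) : Set ℕ) u) :=
    MeasurableSet.pi (Finset.countable_toSet _) fun i _ => hu i
  have hb : Φ.bernoulli (Set.pi (Finset.range N : Set ℕ) (fun i => u (i + 1))) =
      ∏ i ∈ Finset.range N,
        (∑ a, ENNReal.ofReal (Φ.prob a) • Measure.dirac a : Measure A) (u (i + 1)) :=
    Measure.infinitePi_pi _ fun i _ => hu (i + 1)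
  rw [Measure.finsetSum_apply _ _ (u 0), Finset.mul_sum]
  refine Finset.sum_congr rfl fun a _ => ?_
  rw [Measure.smul_apply, Measure.smul_apply, Measure.map_apply (measurable_consSeq a) hm, hpre,
    Measure.dirac_apply' _ (hu 0), ← hb]
  by_cases ha : a ∈ u 0
  · simp [ha, mul_comm]
  · simp [ha]

/-- `μ` is a Borel probability measure with `μ = ∑_a p_a • φ_a μ`. -/
theorem selfSimilarMeasure_spec (Φ : RationalIFS d A) :
    IsProbabilityMeasure Φ.selfSimilarMeasure ∧
      Φ.selfSimilarMeasure =
        ∑ a, ENNReal.ofReal (Φ.prob a) • Φ.selfSimilarMeasure.map (Φ.map a) := by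
  refine ⟨Measure.isProbabilityMeasure_map Φ.measurable_proj.aemeasurable, ?_⟩
  ext B hB
  conv_lhs => rw [selfSimilarMeasure, bernoulli_eq]
  rw [Measure.map_apply Φ.measurable_proj hB, Measure.finsetSum_apply, Measure.finsetSum_apply]
  refine Finset.sum_congr rfl fun a _ => ?_
  have ha := (Φ.continuous_map a).measurable
  rw [Measure.smul_apply, Measure.smul_apply, Measure.map_apply ha hB, selfSimilarMeasure,
    Measure.map_apply Φ.measurable_proj (ha hB),
    Measure.map_apply (measurable_consSeq a) (Φ.measurable_proj hB)]
  congr 2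
  ext ω
  simp only [mem_preimage]
  rw [Φ.proj_eq_map (consSeq a ω)]
  rfl

theorem selfSimilarMeasure_unique (Φ : RationalIFS d A)
    (ν : Measure (EuclideanSpace ℝ (Fin d))) [IsProbabilityMeasure ν]
    (hν : ν = ∑ a, ENNReal.ofReal (Φ.prob a) • ν.map (Φ.map a)) : ν = Φ.selfSimilarMeasure := by
  have key : ∀ (n : ℕ) (f : EuclideanSpace ℝ (Fin d) → ℝ≥0∞), Measurable f →
      ∫⁻ x, f x ∂ν =
        ∫⁻ x, ∫⁻ ω, f (Φ.wordMap (fun i : Fin n => ω i) x) ∂Φ.bernoulli ∂ν := by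
    intro n
    induction n with
    | zero => intro f _; simp [wordMap]
    | succ n ih =>
      intro f hf
      have hin : ∀ x, ∫⁻ ω, f (Φ.wordMap (fun i : Fin (n + 1) => ω i) x) ∂Φ.bernoulli =
          ∑ a, ENNReal.ofReal (Φ.prob a) *
            ∫⁻ ω, f (Φ.map a (Φ.wordMap (fun i : Fin n => ω i) x)) ∂Φ.bernoulli := by
        intro x
        conv_lhs => rw [bernoulli_eq]
        rw [lintegral_finsetSum_measure]
        refine Finset.sum_congr rfl fun a _ => ?_
        rw [lintegral_smul_measure, lintegral_map ?_ (measurable_consSeq a), smul_eq_mul]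
        · simp only [wordMap_cons]
          rfl
        · exact hf.comp ((Φ.measurable_wordMap (n + 1)).comp
            (measurable_id.prodMk measurable_const))
      have hmeas : ∀ a, Measurable fun x => ∫⁻ ω,
          f (Φ.map a (Φ.wordMap (fun i : Fin n => ω i) x)) ∂Φ.bernoulli := fun a =>
        Measurable.lintegral_prod_left (hf.comp
          ((Φ.continuous_map a).measurable.comp (Φ.measurable_wordMap n)))
      conv_lhs => rw [hν]
      simp only [hin]
      rw [lintegral_finsetSum_measure, lintegral_finsetSum _ fun a _ => (hmeas a).const_mul _]
      refine Finset.sum_congr rfl fun a _ => ?_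
      have ha := (Φ.continuous_map a).measurable
      rw [lintegral_smul_measure, lintegral_map hf ha, lintegral_const_mul _ (hmeas a),
        smul_eq_mul, ih (fun x => f (Φ.map a x)) (hf.comp ha)]
  have : IsProbabilityMeasure Φ.selfSimilarMeasure := Φ.selfSimilarMeasure_spec.1
  refine ext_of_forall_lintegral_eq_of_IsFiniteMeasure fun f => ?_
  have hf : Measurable fun x => (f x : ℝ≥0∞) := f.continuous.measurable.coe_nnreal_ennreal
  have hbd : ∀ x, (f x : ℝ≥0∞) ≤ (nndist f 0 : ℝ≥0∞) := fun x =>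
    ENNReal.coe_le_coe.2 (BoundedContinuousFunction.NNReal.upper_bound f x)
  have hw := fun n => hf.comp (Φ.measurable_wordMap n)
  have hinner : ∀ x, Tendsto (fun n : ℕ =>
      ∫⁻ ω, (f (Φ.wordMap (fun i : Fin n => ω i) x) : ℝ≥0∞) ∂Φ.bernoulli) atTop
      (𝓝 (∫⁻ ω, (f (Φ.proj ω) : ℝ≥0∞) ∂Φ.bernoulli)) := by
    intro x
    refine tendsto_lintegral_of_dominated_convergence (fun _ => (nndist f 0 : ℝ≥0∞))
      (fun n => (hw n).comp (measurable_id.prodMk measurable_const))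
      (fun n => ae_of_all _ fun ω => hbd _) (by simp) (ae_of_all _ fun ω => ?_)
    exact (ENNReal.continuous_coe.comp f.continuous).continuousAt.tendsto.comp
      (Φ.tendsto_proj' ω (x := fun _ => x) fun _ => le_rfl)
  have houter : Tendsto (fun n : ℕ =>
      ∫⁻ x, ∫⁻ ω, (f (Φ.wordMap (fun i : Fin n => ω i) x) : ℝ≥0∞) ∂Φ.bernoulli ∂ν) atTop
      (𝓝 (∫⁻ _, ∫⁻ ω, (f (Φ.proj ω) : ℝ≥0∞) ∂Φ.bernoulli ∂ν)) := by
    refine tendsto_lintegral_of_dominated_convergence (fun _ => (nndist f 0 : ℝ≥0∞))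
      (fun n => Measurable.lintegral_prod_left (hw n))
      (fun n => ae_of_all _ fun x => ?_) (by simp) (ae_of_all _ hinner)
    refine (lintegral_mono fun ω => hbd _).trans ?_
    simp
  have hc := tendsto_nhds_unique (tendsto_const_nhds.congr fun n => key n _ hf) houter
  rw [hc, selfSimilarMeasure, lintegral_map hf Φ.measurable_proj]
  simp

end Measure

end

end RationalIFS

/-!
The convergence part is the usual covering argument: a rational point that contributes to
`Ψ_g` does so through a pair `(𝐚, l)`, so that `W**(g)` lies in the limsup set of the balls of
radius `Diam(X_𝐚) g(|𝐚|)` around `π(a_1 … a_l (a_{l+1} … a_n)^∞)`, and each word `𝐚` gives `|𝐚|`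
balls.

For the divergence part, `∑_{𝐚 ∈ A^n} Diam(X_𝐚)^{dim_S}` does not depend on `n`, so the hypothesis
reads `∑ n γ_n = ∞` with `γ_n = min (g(n)^{dim_S}) 1`. If the block of `ω` that follows its first
`n` letters repeats the block that follows its first `l` letters, up to the first length at which
its weight `p_{ω_{n+1}} ⋯ p_{ω_{n+k}}` is less than `γ_n`, then `π(ω)` and the rational point
`π(ω_1 … ω_l (ω_{l+1} … ω_n)^∞)` lie in the same cylinder of diameter less than
`Diam(X_𝐚) g(n)`, where `𝐚 = ω_1 … ω_n` (`exists_rational_near`). Since the length of the block is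
determined by its weight and not fixed in advance, this has probability comparable to `γ_n` for
every `l`, however the two blocks overlap, so the expected number of such pairs `(n, l)` is infinite.

The probabilities are computed with predictable constraints (`lintegral_constraint`): if every
letter has to lie in a set `B t` determined by the earlier letters, then
`1_{all constraints hold} / ∏ p(B t)` has mean `1`. Requiring in addition that the two letters
preceding the blocks differ makes the events pairwise quasi-independent
(`bernoulli_recurrence_inter_le`): when both the targets and the sources of two recurrences overlap,
either the differences `n - l` agree and the events are disjoint, or a further stretch of `ω`
before both targets is prescribed as well. This uses that `l ≤ n / 2` and that blocks have length at
most `n / 3`, which costs nothing in the divergence (`exists_finset_one_le_sum`). The second moment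
method (`sq_le_two_mul_measure_biUnion`) then bounds the probability of recurrences with `l > M`
below, uniformly in `M`, and Kolmogorov's zero-one law gives almost every `ω`
(`ae_mem_lateRecurrence`). Finally `μ` has no atoms (`bernoulli_proj_eq_zero`), so almost every
point is irrational, and rational points at arbitrarily small distances from it are infinitely many.
-/

namespace RationalIFS

/-! ### Predictable constraints on a Bernoulli sequence -/

theorem update_consSeq {A : Type*} [DecidableEq A] (a b : A) (ω : ℕ → A) (t : ℕ) :
    Function.update (consSeq a ω) (t + 1) b = consSeq a (Function.update ω t b) := by
  funext k
  cases k with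
  | zero => simp [consSeq]
  | succ k => simp [consSeq, Function.update_apply]

section Symbolic

variable {d : ℕ} {A : Type*} [Fintype A]

/-- The weight `p_a`, as an extended non-negative real. -/
noncomputable def weight (Φ : RationalIFS d A) (a : A) : ℝ≥0∞ := ENNReal.ofReal (Φ.prob a)

theorem weight_eq_rpow (Φ : RationalIFS d A) (a : A) :
    Φ.weight a = ENNReal.ofReal (Φ.ratio a) ^ Φ.simDim := by
  rw [weight, prob, ENNReal.ofReal_rpow_of_pos (Φ.ratio_pos a)]

theorem weight_ne_zero (Φ : RationalIFS d A) (a : A) : Φ.weight a ≠ 0 := by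
  simpa [weight] using Φ.prob_pos a

theorem sum_weight [Nonempty A] (Φ : RationalIFS d A) : ∑ a, Φ.weight a = 1 := Φ.sum_ofReal_prob

theorem sum_weight_le_one [Nonempty A] (Φ : RationalIFS d A) (B : Finset A) :
    ∑ a ∈ B, Φ.weight a ≤ 1 :=
  (Finset.sum_le_univ_sum_of_nonneg fun _ => zero_le).trans_eq Φ.sum_weight

theorem weight_le_one [Nonempty A] (Φ : RationalIFS d A) (a : A) : Φ.weight a ≤ 1 := by
  simpa using Φ.sum_weight_le_one {a}

theorem sum_weight_ne_zero (Φ : RationalIFS d A) {B : Finset A} (hB : B.Nonempty) :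
    ∑ a ∈ B, Φ.weight a ≠ 0 := by
  obtain ⟨a, ha⟩ := hB
  exact fun h => Φ.weight_ne_zero a (Finset.sum_eq_zero_iff.1 h a ha)

theorem measurable_of_dependsOn_prefix [MeasurableSpace A] [DiscreteMeasurableSpace A]
    {β : Type*} [MeasurableSpace β] (f : (ℕ → A) → β) (T : ℕ)
    (hf : ∀ ω ω' : ℕ → A, (∀ j < T, ω j = ω' j) → f ω = f ω') : Measurable f := by
  classical
  by_cases hA : Nonempty A
  · obtain ⟨a₀⟩ := hA
    have h : f = (fun u : Fin T → A => f fun k => if h : k < T then u ⟨k, h⟩ else a₀) ∘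
        fun ω i => ω i := by
      funext ω
      refine hf _ _ fun j hj => ?_
      simp [hj]
    rw [h]
    exact (measurable_of_countable _).comp (by fun_prop)
  · have : IsEmpty (ℕ → A) := ⟨fun ω => hA ⟨ω 0⟩⟩
    exact measurable_of_countable _

theorem prod_constraint_mul [Nonempty A] [DecidableEq A] (Φ : RationalIFS d A) (T : ℕ)
    (B : ℕ → (ℕ → A) → Finset A) (hne : ∀ t ω, (B t ω).Nonempty) (ω : ℕ → A)
    (hω : ∀ t < T, ω t ∈ B t ω) :
    (∏ t ∈ Finset.range T, ∑ a ∈ B t ω, Φ.weight a) *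
      ∏ t ∈ Finset.range T, (if ω t ∈ B t ω then (∑ a ∈ B t ω, Φ.weight a)⁻¹ else 0) = 1 := by
  rw [← Finset.prod_mul_distrib]
  refine Finset.prod_eq_one fun t ht => ?_
  rw [if_pos (hω t (Finset.mem_range.1 ht))]
  exact ENNReal.mul_inv_cancel (Φ.sum_weight_ne_zero (hne t ω))
    ((Φ.sum_weight_le_one _).trans_lt ENNReal.one_lt_top).ne

variable [Nonempty A] [MeasurableSpace A] [DiscreteMeasurableSpace A]

/-- A product of factors `F t`, where `F t` depends on the letters up to time `t` only and has
conditional mean `1` given the letters before time `t`, has mean `1`. -/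
theorem lintegral_prod_eq_one [DecidableEq A] (Φ : RationalIFS d A) (T : ℕ)
    (F : ℕ → (ℕ → A) → ℝ≥0∞)
    (hdep : ∀ t ω ω', (∀ j ≤ t, ω j = ω' j) → F t ω = F t ω')
    (hsum : ∀ t ω, ∑ a, Φ.weight a * F t (Function.update ω t a) = 1) :
    ∫⁻ ω, ∏ t ∈ Finset.range T, F t ω ∂Φ.bernoulli = 1 := by
  induction T generalizing F with
  | zero => simp
  | succ T ih =>
    have hm : ∀ (T : ℕ) (F : ℕ → (ℕ → A) → ℝ≥0∞),
        (∀ t ω ω', (∀ j ≤ t, ω j = ω' j) → F t ω = F t ω') →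
        Measurable fun ω => ∏ t ∈ Finset.range T, F t ω := fun T F hdep =>
      measurable_of_dependsOn_prefix _ T fun ω ω' h => Finset.prod_congr rfl fun t ht =>
        hdep t _ _ fun j hj => h j (hj.trans_lt (Finset.mem_range.1 ht))
    have hdep' : ∀ (a : A) t ω ω', (∀ j ≤ t, ω j = ω' j) →
        F (t + 1) (consSeq a ω) = F (t + 1) (consSeq a ω') := fun a t ω ω' h =>
      hdep _ _ _ fun j hj => by
        cases j with
        | zero => rfl
        | succ j => exact h j (by omega)
    have key : ∀ a, ∫⁻ ω, ∏ t ∈ Finset.range (T + 1), F t ω ∂Φ.bernoulli.map (consSeq a) =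
        F 0 fun _ => a := by
      intro a
      rw [lintegral_map (hm _ F hdep) (measurable_consSeq a)]
      have h0 : ∀ ω, F 0 (consSeq a ω) = F 0 fun _ => a := fun ω => hdep 0 _ _ fun j hj => by
        obtain rfl : j = 0 := by omega
        rfl
      simp only [Finset.prod_range_succ', h0]
      rw [lintegral_mul_const _ (hm T (fun t ω => F (t + 1) (consSeq a ω)) (hdep' a)),
        ih (fun t ω => F (t + 1) (consSeq a ω)) (hdep' a) fun t ω => ?_, one_mul]
      simp only [← update_consSeq]
      exact hsum (t + 1) (consSeq a ω)
    conv_lhs => rw [bernoulli_eq]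
    rw [lintegral_finsetSum_measure]
    obtain ⟨a₀⟩ := ‹Nonempty A›
    rw [← hsum 0 fun _ => a₀]
    refine Finset.sum_congr rfl fun a _ => ?_
    rw [lintegral_smul_measure, key, smul_eq_mul, weight]
    congr 1
    refine hdep 0 _ _ fun j hj => ?_
    obtain rfl : j = 0 := by omega
    simp

/-- If every letter `ω t` has to lie in a non-empty set `B t ω` that depends on the earlier letters
only, then `1_{∀ t < T, ω t ∈ B t ω} / ∏_{t < T} p(B t ω)` has mean `1`. -/
theorem lintegral_constraint [DecidableEq A] (Φ : RationalIFS d A) (T : ℕ)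
    (B : ℕ → (ℕ → A) → Finset A)
    (hdep : ∀ t ω ω', (∀ j < t, ω j = ω' j) → B t ω = B t ω')
    (hne : ∀ t ω, (B t ω).Nonempty) :
    ∫⁻ ω, ∏ t ∈ Finset.range T, (if ω t ∈ B t ω then (∑ a ∈ B t ω, Φ.weight a)⁻¹ else 0)
      ∂Φ.bernoulli = 1 := by
  refine Φ.lintegral_prod_eq_one T _ (fun t ω ω' h => ?_) fun t ω => ?_
  · rw [hdep t ω ω' fun j hj => h j hj.le, h t le_rfl]
  · have hB : ∀ a, B t (Function.update ω t a) = B t ω := fun a =>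
      hdep _ _ _ fun j hj => Function.update_of_ne hj.ne _ _
    simp only [hB, Function.update_self, mul_ite, mul_zero]
    rw [← Finset.sum_filter, Finset.filter_univ_mem, ← Finset.sum_mul]
    exact ENNReal.mul_inv_cancel (Φ.sum_weight_ne_zero (hne t ω))
      ((Φ.sum_weight_le_one _).trans_lt ENNReal.one_lt_top).ne

theorem bernoulli_le_of_constraint [DecidableEq A] (Φ : RationalIFS d A) (T : ℕ)
    (B : ℕ → (ℕ → A) → Finset A)
    (hdep : ∀ t ω ω', (∀ j < t, ω j = ω' j) → B t ω = B t ω')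
    (hne : ∀ t ω, (B t ω).Nonempty) {S : Set (ℕ → A)} (hSm : MeasurableSet S) {x : ℝ≥0∞}
    (hS : ∀ ω ∈ S, (∀ t < T, ω t ∈ B t ω) ∧
      ∏ t ∈ Finset.range T, ∑ a ∈ B t ω, Φ.weight a ≤ x) : Φ.bernoulli S ≤ x := by
  rw [← lintegral_indicator_one hSm]
  obtain rfl | hx := eq_or_ne x ∞
  · exact le_top
  calc ∫⁻ ω, S.indicator 1 ω ∂Φ.bernoulli
      ≤ ∫⁻ ω, x * ∏ t ∈ Finset.range T,
          (if ω t ∈ B t ω then (∑ a ∈ B t ω, Φ.weight a)⁻¹ else 0) ∂Φ.bernoulli := by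
        refine lintegral_mono fun ω => ?_
        by_cases hω : ω ∈ S
        · obtain ⟨h1, h2⟩ := hS ω hω
          rw [indicator_of_mem hω, Pi.one_apply, ← Φ.prod_constraint_mul T B hne ω h1]
          gcongr
        · rw [indicator_of_notMem hω]
          exact zero_le
    _ = x := by rw [lintegral_const_mul' _ _ hx, Φ.lintegral_constraint T B hdep hne, mul_one]

theorem le_bernoulli_of_constraint [DecidableEq A] (Φ : RationalIFS d A) (T : ℕ)
    (B : ℕ → (ℕ → A) → Finset A)
    (hdep : ∀ t ω ω', (∀ j < t, ω j = ω' j) → B t ω = B t ω')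
    (hne : ∀ t ω, (B t ω).Nonempty) {S : Set (ℕ → A)} (hSm : MeasurableSet S) {x : ℝ≥0∞}
    (hS : ∀ ω, (∀ t < T, ω t ∈ B t ω) →
      ω ∈ S ∧ x ≤ ∏ t ∈ Finset.range T, ∑ a ∈ B t ω, Φ.weight a) : x ≤ Φ.bernoulli S := by
  rw [← lintegral_indicator_one hSm]
  calc x = x * ∫⁻ ω, ∏ t ∈ Finset.range T,
          (if ω t ∈ B t ω then (∑ a ∈ B t ω, Φ.weight a)⁻¹ else 0) ∂Φ.bernoulli := by
        rw [Φ.lintegral_constraint T B hdep hne, mul_one]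
    _ = ∫⁻ ω, x * ∏ t ∈ Finset.range T,
          (if ω t ∈ B t ω then (∑ a ∈ B t ω, Φ.weight a)⁻¹ else 0) ∂Φ.bernoulli := by
        refine (lintegral_const_mul _ (measurable_of_dependsOn_prefix _ T fun ω ω' h => ?_)).symm
        refine Finset.prod_congr rfl fun t ht => ?_
        have ht := Finset.mem_range.1 ht
        rw [hdep t ω ω' fun j hj => h j (hj.trans ht), h t ht]
    _ ≤ _ := by
        refine lintegral_mono fun ω => ?_
        by_cases hω : ∀ t < T, ω t ∈ B t ω
        · obtain ⟨h1, h2⟩ := hS ω hω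
          rw [indicator_of_mem h1, Pi.one_apply, ← Φ.prod_constraint_mul T B hne ω hω]
          gcongr
        · push Not at hω
          obtain ⟨t, ht, hω⟩ := hω
          rw [Finset.prod_eq_zero (Finset.mem_range.2 ht) (if_neg hω), mul_zero]
          exact zero_le

end Symbolic

/-! ### Recurrences of blocks -/

section Recurrence

variable {d : ℕ} {A : Type*} [Fintype A]

/-- The weight `p_{ω_n} ⋯ p_{ω_{n+i-1}}` of the block of length `i` of `ω` starting at time `n`. -/
noncomputable def blockWeight (Φ : RationalIFS d A) (ω : ℕ → A) (n i : ℕ) : ℝ≥0∞ :=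
  ∏ j ∈ Finset.range i, Φ.weight (ω (n + j))

/-- The block of `ω` starting at time `n + 1` coincides with the one starting at time `l + 1`, up to
the first length at which its weight is less than `γ`, and the letters at the times `n` and `l`
preceding the two blocks are different. -/
def recurrence (Φ : RationalIFS d A) (γ : ℝ≥0∞) (n l : ℕ) : Set (ℕ → A) :=
  {ω | ω n ≠ ω l ∧ ∀ i, γ ≤ Φ.blockWeight ω (n + 1) i → ω (n + 1 + i) = ω (l + 1 + i)}

theorem blockWeight_congr (Φ : RationalIFS d A) {ω ω' : ℕ → A} {n n' i : ℕ}
    (h : ∀ j < i, ω (n + j) = ω' (n' + j)) : Φ.blockWeight ω n i = Φ.blockWeight ω' n' i :=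
  Finset.prod_congr rfl fun j hj => by rw [h j (Finset.mem_range.1 hj)]

theorem blockWeight_succ (Φ : RationalIFS d A) (ω : ℕ → A) (n i : ℕ) :
    Φ.blockWeight ω n (i + 1) = Φ.blockWeight ω n i * Φ.weight (ω (n + i)) :=
  Finset.prod_range_succ _ _

theorem blockWeight_le_pow (Φ : RationalIFS d A) {θ : ℝ≥0∞} (hθ : ∀ a, Φ.weight a ≤ θ)
    (ω : ℕ → A) (n i : ℕ) : Φ.blockWeight ω n i ≤ θ ^ i := by
  refine (Finset.prod_le_pow_card (Finset.range i) _ θ fun j _ => hθ _).trans_eq ?_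
  rw [Finset.card_range]

theorem sum_compl_weight [DecidableEq A] (Φ : RationalIFS d A) {c : ℝ≥0∞}
    (hc : ∀ a, c ≤ Φ.weight a) [Nontrivial A] (a : A) : c ≤ ∑ b ∈ {a}ᶜ, Φ.weight b := by
  obtain ⟨b, hb⟩ := exists_ne a
  exact (hc b).trans (Finset.single_le_sum (f := Φ.weight) (fun _ _ => zero_le) (by simpa))

variable [Nonempty A]

theorem blockWeight_antitone (Φ : RationalIFS d A) (ω : ℕ → A) (n : ℕ) :
    Antitone (Φ.blockWeight ω n) :=
  antitone_nat_of_succ_le fun i => by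
    rw [blockWeight_succ]
    exact mul_le_of_le_one_right' (Φ.weight_le_one _)

theorem lt_of_le_blockWeight (Φ : RationalIFS d A) {θ γ : ℝ≥0∞} (hθ : ∀ a, Φ.weight a ≤ θ)
    {K : ℕ} (hK : θ ^ K < γ) {ω : ℕ → A} {n i : ℕ} (h : γ ≤ Φ.blockWeight ω n i) : i < K := by
  by_contra! hi
  exact absurd (h.trans ((Φ.blockWeight_antitone ω n hi).trans (Φ.blockWeight_le_pow hθ ω n K)))
    hK.not_ge

/-- The block starting at time `n` and stopped as soon as its weight drops below `γ` has a weight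
between `(min p) γ` and `γ`. -/
theorem stopped_dichotomy (Φ : RationalIFS d A) (ω : ℕ → A) (n : ℕ) (γ : ℝ≥0∞) (K : ℕ) :
    (γ ≤ Φ.blockWeight ω n K ∧ (∏ i ∈ Finset.range K,
      if γ ≤ Φ.blockWeight ω n i then Φ.weight (ω (n + i)) else 1) = Φ.blockWeight ω n K) ∨
    (Φ.blockWeight ω n K < γ ∧ (∏ i ∈ Finset.range K,
      if γ ≤ Φ.blockWeight ω n i then Φ.weight (ω (n + i)) else 1) < γ ∧
      ∀ c, γ ≤ 1 → (∀ a, c ≤ Φ.weight a) → c * γ ≤ ∏ i ∈ Finset.range K,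
      if γ ≤ Φ.blockWeight ω n i then Φ.weight (ω (n + i)) else 1) := by
  induction K with
  | zero =>
    have h0 : Φ.blockWeight ω n 0 = 1 := by simp [blockWeight]
    by_cases h : γ ≤ 1
    · exact Or.inl ⟨by rwa [h0], by simp [h0]⟩
    · rw [not_le] at h
      exact Or.inr ⟨by rwa [h0], by simpa using h, fun c h' => absurd h' h.not_ge⟩
  | succ K ih =>
    rw [Finset.prod_range_succ, blockWeight_succ]
    rcases ih with ⟨h1, h2⟩ | ⟨h1, h2, h3⟩
    · rw [if_pos h1, h2]
      rcases le_or_gt γ (Φ.blockWeight ω n K * Φ.weight (ω (n + K))) with h | h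
      · exact Or.inl ⟨h, rfl⟩
      · refine Or.inr ⟨h, h, fun c _ hc => ?_⟩
        rw [mul_comm]
        gcongr
        exact hc _
    · rw [if_neg h1.not_ge, mul_one]
      exact Or.inr ⟨(mul_le_of_le_one_right' (Φ.weight_le_one _)).trans_lt h1, h2, h3⟩

theorem stopped_lt (Φ : RationalIFS d A) {θ γ : ℝ≥0∞} (hθ : ∀ a, Φ.weight a ≤ θ)
    {K : ℕ} (hK : θ ^ K < γ) (ω : ℕ → A) (n : ℕ) : (∏ i ∈ Finset.range K,
      if γ ≤ Φ.blockWeight ω n i then Φ.weight (ω (n + i)) else 1) < γ := by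
  rcases Φ.stopped_dichotomy ω n γ K with ⟨h, _⟩ | h
  · exact absurd (h.trans (Φ.blockWeight_le_pow hθ ω n K)) hK.not_ge
  · exact h.2.1

theorem le_stopped (Φ : RationalIFS d A) {θ γ c : ℝ≥0∞} (hθ : ∀ a, Φ.weight a ≤ θ)
    {K : ℕ} (hK : θ ^ K < γ) (hγ : γ ≤ 1) (hc : ∀ a, c ≤ Φ.weight a) (ω : ℕ → A) (n : ℕ) :
    c * γ ≤ ∏ i ∈ Finset.range K,
      if γ ≤ Φ.blockWeight ω n i then Φ.weight (ω (n + i)) else 1 := by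
  rcases Φ.stopped_dichotomy ω n γ K with ⟨h, _⟩ | h
  · exact absurd (h.trans (Φ.blockWeight_le_pow hθ ω n K)) hK.not_ge
  · exact h.2.2 c hγ hc

theorem recurrence_congr (Φ : RationalIFS d A) {θ γ : ℝ≥0∞} (hθ : ∀ a, Φ.weight a ≤ θ)
    {K : ℕ} (hK : θ ^ K < γ) {n l : ℕ} {ω ω' : ℕ → A}
    (h : ∀ j, l ≤ j ∨ n ≤ j → j ≤ max n l + K → ω j = ω' j) :
    ω ∈ Φ.recurrence γ n l ↔ ω' ∈ Φ.recurrence γ n l := by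
  have key : ∀ ω ω' : ℕ → A, (∀ j, l ≤ j ∨ n ≤ j → j ≤ max n l + K → ω j = ω' j) →
      ω ∈ Φ.recurrence γ n l → ω' ∈ Φ.recurrence γ n l := by
    rintro ω ω' h ⟨h1, h2⟩
    refine ⟨?_, fun i hi => ?_⟩
    · rwa [← h n (by omega) (by omega), ← h l (by omega) (by omega)]
    · have hiK := Φ.lt_of_le_blockWeight hθ hK hi
      rw [← h _ (by omega) (by omega), ← h _ (by omega) (by omega)]
      refine h2 i ?_
      rwa [Φ.blockWeight_congr (ω' := ω') (n' := n + 1)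
        fun j hj => h _ (by omega) (by omega)]
  exact ⟨key _ _ h, key _ _ fun j hj hj' => (h j hj hj').symm⟩

variable [MeasurableSpace A] [DiscreteMeasurableSpace A]

theorem measurableSet_recurrence (Φ : RationalIFS d A) {θ γ : ℝ≥0∞} (hθ : ∀ a, Φ.weight a ≤ θ)
    {K : ℕ} (hK : θ ^ K < γ) (n l : ℕ) : MeasurableSet (Φ.recurrence γ n l) :=
  measurable_mem.1 <| measurable_of_dependsOn_prefix _ (max n l + K + 1) fun ω ω' h =>
    propext <| Φ.recurrence_congr hθ hK fun j _ hj => h j (by omega)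

/-- The constraint for a recurrence: from time `n + 1` on, and until the block is stopped, every
letter is prescribed by an earlier one, and the letter at time `n` must not be `ω l`. -/
theorem bernoulli_recurrence (Φ : RationalIFS d A) [Nontrivial A] {θ γ c : ℝ≥0∞}
    (hθ : ∀ a, Φ.weight a ≤ θ) {K : ℕ} (hK : θ ^ K < γ) (hγ : γ ≤ 1)
    (hc : ∀ a, c ≤ Φ.weight a) {n l : ℕ} (hl : l < n) :
    c * (c * γ) ≤ Φ.bernoulli (Φ.recurrence γ n l) ∧ Φ.bernoulli (Φ.recurrence γ n l) ≤ γ := by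
  classical
  let B : ℕ → (ℕ → A) → Finset A := fun t ω =>
    if t = n then {ω l}ᶜ else
    if n + 1 ≤ t ∧ γ ≤ Φ.blockWeight ω (n + 1) (t - (n + 1)) then {ω (l + (t - n))} else
    Finset.univ
  have hdep : ∀ t ω ω', (∀ j < t, ω j = ω' j) → B t ω = B t ω' := by
    intro t ω ω' h
    simp only [B]
    split_ifs with h1 h2 h3 h3
    · rw [h l (by omega)]
    · rw [h _ (by omega)]
    · refine absurd ⟨h2.1, ?_⟩ h3
      rw [← Φ.blockWeight_congr (ω := ω) (n := n + 1) fun j hj => h _ (by omega)]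
      exact h2.2
    · refine absurd ⟨h3.1, ?_⟩ h2
      rw [Φ.blockWeight_congr (ω' := ω') (n' := n + 1) fun j hj => h _ (by omega)]
      exact h3.2
    · rfl
  have hne : ∀ t ω, (B t ω).Nonempty := by
    intro t ω
    simp only [B]
    split_ifs
    · obtain ⟨b, hb⟩ := exists_ne (ω l)
      exact ⟨b, by simpa⟩
    · simp
    · simp
  have hmem : ∀ ω, (∀ t < n + 1 + K, ω t ∈ B t ω) ↔ ω ∈ Φ.recurrence γ n l := by
    intro ω
    constructor
    · intro h
      refine ⟨by simpa [B] using h n (by omega), fun i hi => ?_⟩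
      have := h (n + 1 + i) (by have := Φ.lt_of_le_blockWeight hθ hK hi; omega)
      have e1 : n + 1 + i - (n + 1) = i := by omega
      have e2 : l + (n + 1 + i - n) = l + 1 + i := by omega
      simpa [B, e1, e2, hi, show n + 1 + i ≠ n by omega, show n < n + 1 + i by omega] using this
    · rintro ⟨h1, h2⟩ t ht
      simp only [B]
      split_ifs with h3 h4
      · subst h3; simpa
      · have := h2 _ h4.2
        rw [Finset.mem_singleton]
        convert this using 2 <;> omega
      · simp
  have hprod : ∀ ω ∈ Φ.recurrence γ n l, ∏ t ∈ Finset.range (n + 1 + K), ∑ a ∈ B t ω, Φ.weight a =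
      (∑ a ∈ {ω l}ᶜ, Φ.weight a) * ∏ i ∈ Finset.range K,
        if γ ≤ Φ.blockWeight ω (n + 1) i then Φ.weight (ω (n + 1 + i)) else 1 := by
    rintro ω ⟨-, h2⟩
    rw [Finset.prod_range_add, Finset.prod_range_succ, Finset.prod_eq_one, one_mul]
    · congr 1
      · simp [B]
      · refine Finset.prod_congr rfl fun i _ => ?_
        have e1 : n + 1 + i - (n + 1) = i := by omega
        have e2 : l + (n + 1 + i - n) = l + 1 + i := by omega
        simp only [B, e1, e2, show n + 1 + i ≠ n by omega, if_false]
        split_ifs with h3 h4 h4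
        · rw [Finset.sum_singleton, h2 i h4]
        · exact absurd h3.2 h4
        · exact absurd ⟨by omega, h4⟩ h3
        · exact Φ.sum_weight
    · intro t ht
      have := Finset.mem_range.1 ht
      simp [B, show t ≠ n by omega, show ¬ n < t by omega, Φ.sum_weight]
  have hm := Φ.measurableSet_recurrence hθ hK n l
  refine ⟨Φ.le_bernoulli_of_constraint (n + 1 + K) B hdep hne hm fun ω hω => ?_,
    Φ.bernoulli_le_of_constraint (n + 1 + K) B hdep hne hm fun ω hω => ?_⟩
  · have h := (hmem ω).1 hω
    refine ⟨h, ?_⟩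
    rw [hprod ω h]
    exact mul_le_mul' (Φ.sum_compl_weight hc _) (Φ.le_stopped hθ hK hγ hc ω _)
  · refine ⟨(hmem ω).2 hω, ?_⟩
    rw [hprod ω hω]
    exact (mul_le_mul' (Φ.sum_weight_le_one _) (Φ.stopped_lt hθ hK ω _).le).trans_eq (one_mul γ)

end Recurrence

/-! ### Pairs of recurrences -/

section Pairs

theorem le_blockWeight_iff_of_mem_recurrence {d : ℕ} {A : Type*} [Fintype A] [Nonempty A]
    (Φ : RationalIFS d A) {γ : ℝ≥0∞} {n l : ℕ} {ω : ℕ → A} (h : ω ∈ Φ.recurrence γ n l) (i : ℕ) :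
    γ ≤ Φ.blockWeight ω (n + 1) i ↔ γ ≤ Φ.blockWeight ω (l + 1) i := by
  have key : ∀ i, (∀ j < i, γ ≤ Φ.blockWeight ω (n + 1) j) →
      Φ.blockWeight ω (n + 1) i = Φ.blockWeight ω (l + 1) i := fun i hi =>
    Φ.blockWeight_congr fun j hj => h.2 j (hi j hj)
  refine ⟨fun hi => ?_, fun hi => ?_⟩
  · rwa [← key i fun j hj => hi.trans (Φ.blockWeight_antitone ω _ hj.le)]
  · induction i with
    | zero => simpa [blockWeight] using hi
    | succ i ih =>
      have := ih (hi.trans (Φ.blockWeight_antitone ω _ i.le_succ))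
      rwa [key _ fun j hj => this.trans (Φ.blockWeight_antitone ω _ (by omega))]

variable {d : ℕ} {A : Type*} [Fintype A] [Nonempty A] [MeasurableSpace A]
  [DiscreteMeasurableSpace A]

/-- Two different recurrences are at most as likely to occur together as if the bounds on their
probabilities were those of independent events. Where the two target blocks overlap, three stretches
of `ω` coincide, and the later of the two source stretches is prescribed as well. If the two time
differences are equal, no such stretch exists, as the mismatch before the later block would lie in
the earlier block. -/
theorem bernoulli_recurrence_inter_le_of_le (Φ : RationalIFS d A) {θ γ γ' : ℝ≥0∞}
    (hθ : ∀ a, Φ.weight a ≤ θ) (hθ1 : θ ≤ 1) {K K' : ℕ} (hK : θ ^ K < γ) (hK' : θ ^ K' < γ')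
    {n l n' l' : ℕ} (hn : n ≤ n') (hln : l < n) (hln' : l' < n') (hl : l + K ≤ n)
    (hl' : l' + K ≤ n') (hne : (n, l) ≠ (n', l')) :
    Φ.bernoulli (Φ.recurrence γ n l ∩ Φ.recurrence γ' n' l') ≤ γ * γ' := by
  classical
  obtain ⟨j, rfl⟩ := Nat.exists_eq_add_of_le hn
  set e := min (l + 1 + j) (l' + 1) with he
  set f := max (l + 1 + j) (l' + 1) with hf
  -- `c₁` and `c₂`: time `t` lies in the target block starting at `n + 1`, resp. `n + j + 1`;
  -- `c₃`: time `t` lies in the later copy (from `f` on) of the stretch that both source blocks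
  -- share with the overlap of the target blocks, the earlier copy starting at `e`
  let c₁ : ℕ → (ℕ → A) → Prop := fun t ω =>
    n + 1 ≤ t ∧ γ ≤ Φ.blockWeight ω (n + 1) (t - (n + 1))
  let c₂ : ℕ → (ℕ → A) → Prop := fun t ω =>
    n + j + 1 ≤ t ∧ γ' ≤ Φ.blockWeight ω (n + j + 1) (t - (n + j + 1))
  let c₃ : ℕ → (ℕ → A) → Prop := fun t ω =>
    (t < n + 1 ∧ f ≤ t ∧ e < f) ∧ γ ≤ Φ.blockWeight ω (l + 1) (j + (t - f)) ∧
      γ' ≤ Φ.blockWeight ω (l' + 1) (t - f)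
  have hc₁ : ∀ t ω ω', (∀ j < t, ω j = ω' j) → c₁ t ω = c₁ t ω' := fun t ω ω' h => by
    refine propext (and_congr_right fun ht => ?_)
    rw [Φ.blockWeight_congr fun j hj => h _ (by omega)]
  have hc₂ : ∀ t ω ω', (∀ j < t, ω j = ω' j) → c₂ t ω = c₂ t ω' := fun t ω ω' h => by
    refine propext (and_congr_right fun ht => ?_)
    rw [Φ.blockWeight_congr fun j hj => h _ (by omega)]
  have hc₃ : ∀ t ω ω', (∀ j < t, ω j = ω' j) → c₃ t ω = c₃ t ω' := fun t ω ω' h => by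
    refine propext (and_congr_right fun ht => ?_)
    rw [Φ.blockWeight_congr (n := l + 1) fun j hj => h _ (by omega),
      Φ.blockWeight_congr (n := l' + 1) fun j hj => h _ (by omega)]
  let B : ℕ → (ℕ → A) → Finset A := fun t ω =>
    if c₁ t ω then {ω (l + (t - n))} else if c₂ t ω then {ω (l' + (t - (n + j)))} else
    if c₃ t ω then {ω (e + (t - f))} else Finset.univ
  have hdep : ∀ t ω ω', (∀ j < t, ω j = ω' j) → B t ω = B t ω' := by
    intro t ω ω' h
    simp only [B]
    refine ite_congr (hc₁ t ω ω' h) (fun h1 => ?_) fun _ => ite_congr (hc₂ t ω ω' h)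
      (fun h1 => ?_) fun _ => ite_congr (hc₃ t ω ω' h) (fun h1 => ?_) fun _ => rfl
    all_goals
      have := h1.1
      rw [h _ (by omega)]
  have hBne : ∀ t ω, (B t ω).Nonempty := by
    intro t ω
    simp only [B]
    split_ifs <;> simp
  have hm := (Φ.measurableSet_recurrence hθ hK n l).inter
    (Φ.measurableSet_recurrence hθ hK' (n + j) l')
  refine Φ.bernoulli_le_of_constraint (n + 1 + (j + K + K')) B hdep hBne hm ?_
  rintro ω ⟨hω, hω'⟩
  have hs := Φ.le_blockWeight_iff_of_mem_recurrence hω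
  have hs' := Φ.le_blockWeight_iff_of_mem_recurrence hω'
  have h₁ : ∀ t, c₁ t ω → ω t = ω (l + (t - n)) := fun t ht => by
    have h1 := ht.1
    convert hω.2 _ ht.2 using 2 <;> omega
  have h₂ : ∀ t, c₂ t ω → ω t = ω (l' + (t - (n + j))) := fun t ht => by
    have h1 := ht.1
    convert hω'.2 _ ht.2 using 2 <;> omega
  have h₃' : ∀ i, γ ≤ Φ.blockWeight ω (l + 1) (j + i) → γ' ≤ Φ.blockWeight ω (l' + 1) i →
      ω (l + 1 + j + i) = ω (n + j + 1 + i) ∧ ω (l' + 1 + i) = ω (n + j + 1 + i) := by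
    intro i h1 h2
    refine ⟨?_, (hω'.2 i ((hs' i).2 h2)).symm⟩
    convert (hω.2 (j + i) ((hs _).2 h1)).symm using 2 <;> omega
  have h₃ : ∀ i, γ ≤ Φ.blockWeight ω (l + 1) (j + i) → γ' ≤ Φ.blockWeight ω (l' + 1) i →
      ω (f + i) = ω (n + j + 1 + i) ∧ ω (e + i) = ω (n + j + 1 + i) := by
    intro i h1 h2
    obtain ⟨h3, h4⟩ := h₃' i h1 h2
    rcases le_total (l + 1 + j) (l' + 1) with h | h
    · rw [hf, he, max_eq_right h, min_eq_left h]
      exact ⟨h4, h3⟩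
    · rw [hf, he, max_eq_left h, min_eq_right h]
      exact ⟨h3, h4⟩
  have h₃t : ∀ t, c₃ t ω → ω t = ω (e + (t - f)) := fun t ht => by
    have h1 := ht.1
    obtain ⟨h2, h3⟩ := h₃ _ ht.2.1 ht.2.2
    rw [h3, ← h2]
    congr 1
    omega
  refine ⟨fun t _ => ?_, ?_⟩
  · simp only [B]
    split_ifs with h1 h2 h3
    · exact Finset.mem_singleton.2 (h₁ t h1)
    · exact Finset.mem_singleton.2 (h₂ t h2)
    · exact Finset.mem_singleton.2 (h₃t t h3)
    · exact Finset.mem_univ _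
  let G₁ : ℕ → ℝ≥0∞ := fun t => if c₁ t ω then Φ.weight (ω t) else 1
  let G₂ : ℕ → ℝ≥0∞ := fun t => if ¬ c₁ t ω ∧ c₂ t ω then Φ.weight (ω t) else 1
  let G₃ : ℕ → ℝ≥0∞ := fun t => if c₃ t ω then Φ.weight (ω t) else 1
  have hG₃ : ∀ t, G₃ t ≤ 1 := fun t => by
    simp only [G₃]
    split_ifs
    exacts [Φ.weight_le_one _, le_rfl]
  have hsplit : ∀ t, ∑ a ∈ B t ω, Φ.weight a = G₁ t * (G₂ t * G₃ t) := by
    intro t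
    have h13 : c₁ t ω → ¬ c₃ t ω := fun h1 h3 => by
      have h1 := h1.1
      have h3 := h3.1
      omega
    have h23 : c₂ t ω → ¬ c₃ t ω := fun h1 h3 => by
      have h1 := h1.1
      have h3 := h3.1
      omega
    simp only [B, G₁, G₂, G₃]
    by_cases h1 : c₁ t ω
    · rw [if_pos h1, if_pos h1, if_neg fun h => h.1 h1, if_neg (h13 h1), mul_one, mul_one,
        Finset.sum_singleton, ← h₁ t h1]
    by_cases h2 : c₂ t ω
    · rw [if_neg h1, if_pos h2, if_neg h1, if_pos ⟨h1, h2⟩, if_neg (h23 h2), one_mul, mul_one,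
        Finset.sum_singleton, ← h₂ t h2]
    by_cases h3 : c₃ t ω
    · rw [if_neg h1, if_neg h2, if_pos h3, if_neg h1, if_neg fun h => h2 h.2, if_pos h3, one_mul,
        one_mul, Finset.sum_singleton, ← h₃t t h3]
    · rw [if_neg h1, if_neg h2, if_neg h3, if_neg h1, if_neg fun h => h2 h.2, if_neg h3, one_mul,
        one_mul, Φ.sum_weight]
  have hpow : ∀ {δ : ℝ≥0∞} {k k' : ℕ}, θ ^ k < δ → k ≤ k' → θ ^ k' < δ := fun h hk =>
    (pow_le_pow_right_of_le_one' hθ1 hk).trans_lt h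
  have hP₁ : ∏ t ∈ Finset.range (n + 1 + (j + K + K')), G₁ t ≤ γ := by
    rw [Finset.prod_range_add, Finset.prod_eq_one, one_mul]
    · refine le_of_eq_of_le (Finset.prod_congr rfl fun i _ => ?_)
        (Φ.stopped_lt hθ (hpow hK (show K ≤ j + K + K' by omega)) ω (n + 1)).le
      simp [G₁, c₁, show n < n + 1 + i by omega]
    · intro t ht
      refine if_neg fun h => ?_
      have h1 := h.1
      have := Finset.mem_range.1 ht
      omega
  have hP₂ : ∏ t ∈ Finset.range (n + 1 + (j + K + K')), G₂ t =
      ∏ i ∈ Finset.range (K + K'), G₂ (n + j + 1 + i) := by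
    rw [show n + 1 + (j + K + K') = n + j + 1 + (K + K') by omega, Finset.prod_range_add,
      Finset.prod_eq_one, one_mul]
    intro t ht
    refine if_neg fun h => ?_
    have h1 := h.2.1
    have := Finset.mem_range.1 ht
    omega
  have hP₃ : ∏ t ∈ Finset.range (n + 1 + (j + K + K')), G₃ t ≤
      ∏ i ∈ Finset.range (K + K'), G₃ (f + i) := by
    rw [show n + 1 + (j + K + K') = f + (K + K') + (n + j + 1 - f) by omega,
      Finset.prod_range_add, Finset.prod_range_add, Finset.prod_eq_one (s := Finset.range f),
      one_mul]
    · exact mul_le_of_le_one_right' (Finset.prod_le_one' fun t _ => hG₃ _)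
    · intro t ht
      refine if_neg fun h => ?_
      have h1 := h.1
      have := Finset.mem_range.1 ht
      omega
  -- a letter of the second target block that is already prescribed by the first one is paid for by
  -- its copy in the source stretch starting at `f`
  have hP₂₃ : ∀ i, G₂ (n + j + 1 + i) * G₃ (f + i) ≤
      if γ' ≤ Φ.blockWeight ω (n + j + 1) i then Φ.weight (ω (n + j + 1 + i)) else 1 := by
    intro i
    have e1 : n + j + 1 + i - (n + 1) = j + i := by omega
    have e2 : n + j + 1 + i - (n + j + 1) = i := by omega
    split_ifs with h2
    · by_cases h1 : γ ≤ Φ.blockWeight ω (n + 1) (j + i)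
      · have hji := Φ.lt_of_le_blockWeight hθ hK h1
        have hef : e < f := by
          by_contra! hef
          -- equal time differences: the mismatch at time `n + j` lies in the earlier block
          obtain ⟨j, rfl⟩ : ∃ j', j = j' + 1 := Nat.exists_eq_succ_of_ne_zero fun hj => by
            refine hne (Prod.ext ?_ ?_) <;> simp only <;> omega
          refine hω'.1 ?_
          convert hω.2 j (h1.trans (Φ.blockWeight_antitone ω _ (by omega))) using 2 <;> omega
        have h3 : c₃ (f + i) ω := by
          refine ⟨by omega, ?_⟩
          rw [Nat.add_sub_cancel_left, ← hs, ← hs']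
          exact ⟨h1, h2⟩
        have h4 : G₃ (f + i) = Φ.weight (ω (n + j + 1 + i)) := by
          simp only [G₃, if_pos h3, (h₃ i ((hs _).1 h1) ((hs' _).1 h2)).1]
        rw [h4]
        refine mul_le_of_le_one_left' ?_
        simp only [G₂]
        split_ifs
        exacts [Φ.weight_le_one _, le_rfl]
      · have h3 : G₂ (n + j + 1 + i) = Φ.weight (ω (n + j + 1 + i)) :=
          if_pos ⟨fun h => h1 (by simpa only [e1] using h.2), by omega, by rwa [e2]⟩
        rw [h3]
        exact mul_le_of_le_one_right' (hG₃ _)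
    · refine mul_le_one' ?_ (hG₃ _)
      simp only [G₂]
      split_ifs
      exacts [Φ.weight_le_one _, le_rfl]
  calc ∏ t ∈ Finset.range (n + 1 + (j + K + K')), ∑ a ∈ B t ω, Φ.weight a
      = (∏ t ∈ Finset.range (n + 1 + (j + K + K')), G₁ t) *
        ((∏ t ∈ Finset.range (n + 1 + (j + K + K')), G₂ t) *
          ∏ t ∈ Finset.range (n + 1 + (j + K + K')), G₃ t) := by
        rw [← Finset.prod_mul_distrib, ← Finset.prod_mul_distrib]
        exact Finset.prod_congr rfl fun t _ => hsplit t
    _ ≤ γ * ((∏ i ∈ Finset.range (K + K'), G₂ (n + j + 1 + i)) *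
          ∏ i ∈ Finset.range (K + K'), G₃ (f + i)) := by
        rw [hP₂]
        gcongr
    _ ≤ γ * γ' := by
        rw [← Finset.prod_mul_distrib]
        gcongr
        exact (Finset.prod_le_prod' fun i _ => hP₂₃ i).trans
          (Φ.stopped_lt hθ (hpow hK' (by omega)) ω _).le

theorem bernoulli_recurrence_inter_le (Φ : RationalIFS d A) {θ γ γ' : ℝ≥0∞}
    (hθ : ∀ a, Φ.weight a ≤ θ) (hθ1 : θ ≤ 1) {n l n' l' : ℕ} (hK : θ ^ (n / 3) < γ)
    (hK' : θ ^ (n' / 3) < γ') (hln : l < n) (hln' : l' < n') (hl : 2 * l ≤ n)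
    (hl' : 2 * l' ≤ n') (hne : (n, l) ≠ (n', l')) :
    Φ.bernoulli (Φ.recurrence γ n l ∩ Φ.recurrence γ' n' l') ≤ γ * γ' := by
  rcases le_total n n' with h | h
  · exact Φ.bernoulli_recurrence_inter_le_of_le hθ hθ1 hK hK' h hln hln' (by omega) (by omega) hne
  · rw [inter_comm, mul_comm]
    exact Φ.bernoulli_recurrence_inter_le_of_le hθ hθ1 hK' hK h hln' hln (by omega) (by omega)
      hne.symm

end Pairs

end RationalIFS

/-! ### The second moment method -/

section SecondMoment

variable {Ω ι : Type*} [MeasurableSpace Ω] {μ : Measure Ω}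

/-- The Cauchy–Schwarz inequality for the number of events that occur. -/
theorem sq_sum_measure_le (J : Finset ι) (E : ι → Set Ω) (hE : ∀ i, MeasurableSet (E i)) :
    (∑ i ∈ J, μ (E i)) ^ 2 ≤ μ (⋃ i ∈ J, E i) * ∑ i ∈ J, ∑ j ∈ J, μ (E i ∩ E j) := by
  set U := ⋃ i ∈ J, E i with hU
  have hUm : MeasurableSet U := J.measurableSet_biUnion fun i _ => hE i
  let Z : Ω → ℝ≥0∞ := fun x => ∑ i ∈ J, (E i).indicator 1 x
  have hZm : Measurable Z := Finset.measurable_sum _ fun i _ => measurable_one.indicator (hE i)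
  have h1 : ∫⁻ x, Z x ∂μ = ∑ i ∈ J, μ (E i) := by
    rw [lintegral_finsetSum _ fun i _ => measurable_one.indicator (hE i)]
    exact Finset.sum_congr rfl fun i _ => lintegral_indicator_one (hE i)
  have h2 : ∫⁻ x, Z x ^ (2 : ℝ) ∂μ = ∑ i ∈ J, ∑ j ∈ J, μ (E i ∩ E j) := by
    have : ∀ x, Z x ^ (2 : ℝ) = ∑ i ∈ J, ∑ j ∈ J, (E i ∩ E j).indicator 1 x := fun x => by
      rw [ENNReal.rpow_two, sq, Finset.sum_mul_sum]
      refine Finset.sum_congr rfl fun i _ => Finset.sum_congr rfl fun j _ => ?_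
      rw [inter_indicator_one, Pi.mul_apply]
    simp only [this]
    rw [lintegral_finsetSum _ fun i _ => Finset.measurable_sum _ fun j _ =>
      measurable_one.indicator ((hE i).inter (hE j))]
    refine Finset.sum_congr rfl fun i _ => ?_
    rw [lintegral_finsetSum _ fun j _ => measurable_one.indicator ((hE i).inter (hE j))]
    exact Finset.sum_congr rfl fun j _ => lintegral_indicator_one ((hE i).inter (hE j))
  have h3 : ∫⁻ x, U.indicator 1 x ^ (2 : ℝ) ∂μ = μ U := by
    rw [← lintegral_indicator_one hUm]
    refine lintegral_congr fun x => ?_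
    by_cases hx : x ∈ U <;> simp [hx]
  have h4 : ∀ x, Z x = (Z * (U.indicator 1 : Ω → ℝ≥0∞)) x := fun x => by
    by_cases hx : x ∈ U
    · rw [Pi.mul_apply, indicator_of_mem hx, Pi.one_apply, mul_one]
    · rw [Pi.mul_apply, indicator_of_notMem hx, mul_zero]
      refine Finset.sum_eq_zero fun i hi => indicator_of_notMem (fun h => hx ?_) _
      exact mem_biUnion hi h
  have h5 := ENNReal.lintegral_mul_le_Lp_mul_Lq μ Real.HolderConjugate.two_two
    hZm.aemeasurable (measurable_one.indicator hUm).aemeasurable (g := U.indicator 1)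
  rw [h2, h3, ← lintegral_congr h4, h1] at h5
  calc (∑ i ∈ J, μ (E i)) ^ 2
      ≤ ((∑ i ∈ J, ∑ j ∈ J, μ (E i ∩ E j)) ^ (1 / 2 : ℝ) * μ U ^ (1 / 2 : ℝ)) ^ 2 := by gcongr
    _ = _ := by
      rw [mul_pow, ← ENNReal.rpow_two, ← ENNReal.rpow_two, ← ENNReal.rpow_mul, ← ENNReal.rpow_mul]
      norm_num
      rw [mul_comm]

theorem sq_le_two_mul_measure_biUnion (J : Finset ι) (E : ι → Set Ω)
    (hE : ∀ i, MeasurableSet (E i)) (γ : ι → ℝ≥0∞) (c : ℝ≥0∞) (hγ : ∀ i ∈ J, γ i ≠ ∞)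
    (hl : ∀ i ∈ J, c * γ i ≤ μ (E i)) (hu : ∀ i ∈ J, μ (E i) ≤ γ i)
    (hp : ∀ i ∈ J, ∀ j ∈ J, i ≠ j → μ (E i ∩ E j) ≤ γ i * γ j) (h1 : 1 ≤ ∑ i ∈ J, γ i) :
    c ^ 2 ≤ 2 * μ (⋃ i ∈ J, E i) := by
  classical
  set S := ∑ i ∈ J, γ i with hS
  have hS0 : S ≠ 0 := (zero_lt_one.trans_le h1).ne'
  have hSt : S ≠ ∞ := ENNReal.sum_ne_top.2 hγ
  have h2 : ∑ i ∈ J, ∑ j ∈ J, μ (E i ∩ E j) ≤ S + S * S := by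
    calc ∑ i ∈ J, ∑ j ∈ J, μ (E i ∩ E j)
        ≤ ∑ i ∈ J, ∑ j ∈ J, ((if i = j then γ j else 0) + γ i * γ j) := by
          refine Finset.sum_le_sum fun i hi => Finset.sum_le_sum fun j hj => ?_
          split_ifs with h
          · subst h
            rw [inter_self]
            exact (hu i hi).trans le_self_add
          · rw [zero_add]
            exact hp i hi j hj h
      _ = S + S * S := by
          simp only [Finset.sum_add_distrib, Finset.sum_ite_eq]
          rw [hS, Finset.sum_mul_sum]
          congr 1
          exact Finset.sum_congr rfl fun i hi => if_pos hi
  have h3 : c ^ 2 * (S * S) ≤ 2 * μ (⋃ i ∈ J, E i) * (S * S) :=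
    calc c ^ 2 * (S * S) = (∑ i ∈ J, c * γ i) ^ 2 := by rw [← Finset.mul_sum]; ring
      _ ≤ (∑ i ∈ J, μ (E i)) ^ 2 := by
        gcongr with i hi
        exact hl i hi
      _ ≤ μ (⋃ i ∈ J, E i) * (S + S * S) := (sq_sum_measure_le J E hE).trans (by gcongr)
      _ ≤ μ (⋃ i ∈ J, E i) * (S * S + S * S) := by
        gcongr
        exact le_mul_of_one_le_left' h1
      _ = _ := by ring
  exact (ENNReal.mul_le_mul_iff_left (mul_ne_zero hS0 hS0) (ENNReal.mul_ne_top hSt hSt)).1 h3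

end SecondMoment

/-- If `∑ n γ_n` diverges, then so does the sum of `γ_n` over the pairs `(n, l)` with
`M < l ≤ n / 2`, even if `n` is restricted to those with `γ_n` not exponentially small. -/
theorem exists_finset_one_le_sum {γ : ℕ → ℝ≥0∞} (hγ1 : ∀ n, γ n ≤ 1)
    (hγ : ∑' n : ℕ, (n : ℝ≥0∞) * γ n = ∞) {ρ : ℝ≥0∞} (hρ0 : ρ ≠ 0) (hρ1 : ρ < 1) (M : ℕ) :
    ∃ J : Finset (ℕ × ℕ), (∀ i ∈ J, M < i.2 ∧ i.2 < i.1 ∧ 2 * i.2 ≤ i.1 ∧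
      (ρ ^ 3) ^ (i.1 / 3) < γ i.1) ∧ 1 ≤ ∑ i ∈ J, γ i.1 := by
  classical
  let good : Set ℕ := {n | 4 * (M + 1) ≤ n ∧ (ρ ^ 3) ^ (n / 3) < γ n}
  have hsmall : ∑' n : ℕ, (n : ℝ≥0∞) * (ρ ^ n / ρ ^ 2) ≠ ∞ := by
    lift ρ to ℝ≥0 using hρ1.ne_top
    have hs : Summable fun n : ℕ => (n : ℝ≥0) * (ρ ^ n / ρ ^ 2) := by
      have h := summable_pow_mul_geometric_of_norm_lt_one (R := ℝ) 1 (r := (ρ : ℝ))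
        (by simpa using hρ1)
      rw [← NNReal.summable_coe]
      refine (h.div_const ((ρ : ℝ) ^ 2)).congr fun n => ?_
      push_cast
      ring
    have h2 : (ρ : ℝ≥0) ^ 2 ≠ 0 := pow_ne_zero _ (by simpa using hρ0)
    convert ENNReal.tsum_coe_ne_top_iff_summable.2 hs using 4 with n
    rw [ENNReal.coe_mul, ENNReal.coe_div h2]
    simp
  have hbad : ∀ n : ℕ, (n : ℝ≥0∞) * γ n ≤ good.indicator (fun n : ℕ => (n : ℝ≥0∞) * γ n) n +
      ((n : ℝ≥0∞) * (ρ ^ n / ρ ^ 2) +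
        (Finset.range (4 * (M + 1)) : Set ℕ).indicator (fun n : ℕ => (n : ℝ≥0∞)) n) := by
    intro n
    by_cases h1 : 4 * (M + 1) ≤ n
    · by_cases h2 : (ρ ^ 3) ^ (n / 3) < γ n
      · rw [indicator_of_mem (show n ∈ good from ⟨h1, h2⟩)]
        exact le_self_add
      · refine le_trans ?_ (le_self_add.trans le_add_self)
        gcongr
        rw [ENNReal.le_div_iff_mul_le (Or.inl (pow_ne_zero _ hρ0))
          (Or.inl (ENNReal.pow_ne_top hρ1.ne_top))]
        calc γ n * ρ ^ 2 ≤ (ρ ^ 3) ^ (n / 3) * ρ ^ 2 := by gcongr; exact not_lt.1 h2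
          _ = ρ ^ (3 * (n / 3) + 2) := by rw [← pow_mul, ← pow_add]
          _ ≤ ρ ^ n := pow_le_pow_right_of_le_one' hρ1.le (by omega)
    · refine le_trans ?_ (le_add_self.trans le_add_self)
      rw [indicator_of_mem (by simpa using h1)]
      exact mul_le_of_le_one_right' (hγ1 n)
  have hgood : ∑' n : ℕ, good.indicator (fun n : ℕ => (n : ℝ≥0∞) * γ n) n = ∞ := by
    by_contra h
    refine absurd hγ (ne_top_of_le_ne_top ?_ (ENNReal.tsum_le_tsum hbad))
    rw [ENNReal.tsum_add, ENNReal.tsum_add]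
    refine ENNReal.add_ne_top.2 ⟨h, ENNReal.add_ne_top.2 ⟨hsmall, ?_⟩⟩
    rw [← tsum_subtype, Finset.tsum_subtype' (Finset.range _) fun n : ℕ => (n : ℝ≥0∞)]
    exact ENNReal.sum_ne_top.2 fun n _ => ENNReal.natCast_ne_top n
  obtain ⟨s, hs⟩ : ∃ s : Finset ℕ, 4 < ∑ n ∈ s, good.indicator (fun n : ℕ => (n : ℝ≥0∞) * γ n) n := by
    rw [ENNReal.tsum_eq_iSup_sum] at hgood
    exact lt_iSup_iff.1 (hgood ▸ by simp)
  let J₀ := (s.filter (· ∈ good)).sigma fun n => Finset.Ioc M (n / 2)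
  refine ⟨J₀.map (Equiv.sigmaEquivProd ℕ ℕ).toEmbedding, ?_, ?_⟩
  · intro i hi
    obtain ⟨⟨n, l⟩, hnl, rfl⟩ := Finset.mem_map.1 hi
    obtain ⟨hn, hl⟩ := Finset.mem_sigma.1 hnl
    have hn := (Finset.mem_filter.1 hn).2
    have hl := Finset.mem_Ioc.1 hl
    have := hn.1
    simp only [Equiv.coe_toEmbedding, Equiv.sigmaEquivProd_apply] at hl ⊢
    exact ⟨hl.1, by omega, by omega, hn.2⟩
  · rw [Finset.sum_map, Finset.sum_sigma]
    simp only [Equiv.coe_toEmbedding, Equiv.sigmaEquivProd_apply, Finset.sum_const, Nat.card_Ioc]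
    have h4 : (4 : ℝ≥0∞) * 1 ≤ 4 * ∑ n ∈ s.filter (· ∈ good), (n / 2 - M) • γ n := by
      rw [mul_one]
      refine hs.le.trans ?_
      rw [← Finset.sum_filter_add_sum_filter_not s (· ∈ good), Finset.mul_sum]
      rw [Finset.sum_eq_zero (s := s.filter (· ∉ good)) fun n hn =>
        indicator_of_notMem (Finset.mem_filter.1 hn).2 _, add_zero]
      refine Finset.sum_le_sum fun n hn => ?_
      have hn := (Finset.mem_filter.1 hn).2
      rw [indicator_of_mem hn, nsmul_eq_mul, ← mul_assoc]
      gcongr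
      have := hn.1
      exact_mod_cast (show n ≤ 4 * (n / 2 - M) by omega)
    exact (ENNReal.mul_le_mul_iff_right (by simp) (by simp)).1 h4

theorem tsum_mul_min_one_eq_top {f : ℕ → ℝ≥0∞} (hf : ∀ n, f n ≠ ∞)
    (h : ∑' n : ℕ, ((n + 1 : ℕ) : ℝ≥0∞) * f n = ∞) :
    ∑' n : ℕ, (n : ℝ≥0∞) * min (f n) 1 = ∞ := by
  by_contra hne
  have hev := (ENNReal.tendsto_atTop_zero_of_tsum_ne_top hne).eventually
    (gt_mem_nhds zero_lt_one)
  obtain ⟨N, hN⟩ := eventually_atTop.1 (hev.and (eventually_ge_atTop 1))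
  have hle : ∀ n : ℕ, ((n + 1 : ℕ) : ℝ≥0∞) * f n ≤ 2 * ((n : ℝ≥0∞) * min (f n) 1) +
      (Finset.range N : Set ℕ).indicator (fun n : ℕ => ((n + 1 : ℕ) : ℝ≥0∞) * f n) n := by
    intro n
    by_cases hn : N ≤ n
    · obtain ⟨h1, h2⟩ := hN n hn
      have h3 : min (f n) 1 = f n := by
        refine min_eq_left (le_of_not_gt fun h3 => h1.not_ge ?_)
        rw [min_eq_right h3.le, mul_one]
        exact_mod_cast h2
      rw [h3, ← mul_assoc]
      refine le_trans ?_ le_self_add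
      gcongr
      exact_mod_cast (show n + 1 ≤ 2 * n by omega)
    · rw [indicator_of_mem (by simpa using hn)]
      exact le_add_self
  refine absurd h (ne_top_of_le_ne_top ?_ (ENNReal.tsum_le_tsum hle))
  rw [ENNReal.tsum_add, ENNReal.tsum_mul_left, ← tsum_subtype,
    Finset.tsum_subtype' (Finset.range N) fun n : ℕ => ((n + 1 : ℕ) : ℝ≥0∞) * f n]
  exact ENNReal.add_ne_top.2 ⟨ENNReal.mul_ne_top (by simp) hne,
    ENNReal.sum_ne_top.2 fun n _ => ENNReal.mul_ne_top (ENNReal.natCast_ne_top _) (hf n)⟩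

namespace RationalIFS

section ZeroOne

variable {d : ℕ} {A : Type*} [Fintype A]

/-- The event that `ω` has a recurrence with threshold `γ n` at a pair of times `M < l < n`. If the
weights are at most `ρ ^ 3`, the condition on `γ n` bounds the length of the block by `n / 3`. -/
def lateRecurrence (Φ : RationalIFS d A) (ρ : ℝ≥0∞) (γ : ℕ → ℝ≥0∞) (M : ℕ) : Set (ℕ → A) :=
  ⋃ i ∈ {i : ℕ × ℕ | M < i.2 ∧ i.2 < i.1 ∧ (ρ ^ 3) ^ (i.1 / 3) < γ i.1},
    Φ.recurrence (γ i.1) i.1 i.2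

theorem lateRecurrence_antitone (Φ : RationalIFS d A) (ρ : ℝ≥0∞) (γ : ℕ → ℝ≥0∞) :
    Antitone (Φ.lateRecurrence ρ γ) := fun _ _ h =>
  biUnion_subset_biUnion_left fun _ hi => ⟨h.trans_lt hi.1, hi.2⟩

variable [Nontrivial A] [MeasurableSpace A] [DiscreteMeasurableSpace A]

theorem le_bernoulli_lateRecurrence (Φ : RationalIFS d A) {γ : ℕ → ℝ≥0∞} (hγ1 : ∀ n, γ n ≤ 1)
    (hγ : ∑' n : ℕ, (n : ℝ≥0∞) * γ n = ∞) {ρ c : ℝ≥0∞} (hρ0 : ρ ≠ 0) (hρ1 : ρ < 1)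
    (hρ : ∀ a, Φ.weight a ≤ ρ ^ 3) (hc : ∀ a, c ≤ Φ.weight a) (M : ℕ) :
    (c * c) ^ 2 ≤ 2 * Φ.bernoulli (Φ.lateRecurrence ρ γ M) := by
  obtain ⟨J, hJ, h1⟩ := exists_finset_one_le_sum hγ1 hγ hρ0 hρ1 M
  have hρ3 : ρ ^ 3 ≤ 1 := pow_le_one' hρ1.le _
  let E : ℕ × ℕ → Set (ℕ → A) := fun i =>
    {ω | i ∈ J ∧ ω ∈ Φ.recurrence (γ i.1) i.1 i.2}
  have hEJ : ∀ i ∈ J, E i = Φ.recurrence (γ i.1) i.1 i.2 := fun i hi => by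
    ext ω
    exact and_iff_right hi
  have hE : ∀ i, MeasurableSet (E i) := fun i => by
    by_cases hi : i ∈ J
    · rw [hEJ i hi]
      exact Φ.measurableSet_recurrence hρ (hJ i hi).2.2.2 _ _
    · have : E i = ∅ := eq_empty_of_forall_notMem fun ω h => hi h.1
      rw [this]
      exact MeasurableSet.empty
  refine (sq_le_two_mul_measure_biUnion J E hE (fun i => γ i.1) (c * c)
    (fun i _ => ((hγ1 _).trans_lt ENNReal.one_lt_top).ne) (fun i hi => ?_) (fun i hi => ?_)
    (fun i hi j hj hij => ?_) h1).trans (mul_le_mul_right (measure_mono ?_) _)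
  · obtain ⟨-, h2, h3, h4⟩ := hJ i hi
    rw [hEJ i hi, mul_assoc]
    exact (Φ.bernoulli_recurrence hρ h4 (hγ1 _) hc h2).1
  · obtain ⟨-, h2, h3, h4⟩ := hJ i hi
    rw [hEJ i hi]
    exact (Φ.bernoulli_recurrence hρ h4 (hγ1 _) hc h2).2
  · obtain ⟨-, h2, h3, h4⟩ := hJ i hi
    obtain ⟨-, h2', h3', h4'⟩ := hJ j hj
    rw [hEJ i hi, hEJ j hj]
    exact Φ.bernoulli_recurrence_inter_le hρ hρ3 h4 h4' h2 h2' h3 h3' hij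
  · refine iUnion₂_subset fun i hi => ?_
    rw [hEJ i hi]
    obtain ⟨h1, h2, h3, h4⟩ := hJ i hi
    exact subset_biUnion_of_mem (u := fun i : ℕ × ℕ => Φ.recurrence (γ i.1) i.1 i.2)
      (show i ∈ {i : ℕ × ℕ | _} from ⟨h1, h2, h4⟩)

theorem measurableSet_recurrence_iSup (Φ : RationalIFS d A) {θ γ : ℝ≥0∞}
    (hθ : ∀ a, Φ.weight a ≤ θ) {K : ℕ} (hK : θ ^ K < γ) {M n l : ℕ} (hl : M ≤ l) (hn : M ≤ n) :
    MeasurableSet[⨆ k ≥ M, MeasurableSpace.comap (fun ω : ℕ → A => ω k) inferInstance]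
      (Φ.recurrence γ n l) := by
  have hshift : @Measurable _ _
      (⨆ k ≥ M, MeasurableSpace.comap (fun ω : ℕ → A => ω k) inferInstance) _
      (fun (ω : ℕ → A) (k : ℕ) => ω (M + k)) :=
    @measurable_pi_lambda _ _ _ (_) _ _ fun k => Measurable.mono (comap_measurable _)
      (le_iSup₂_of_le (M + k) (by simp) le_rfl) le_rfl
  have h : Φ.recurrence γ n l =
      (fun (ω : ℕ → A) (k : ℕ) => ω (M + k)) ⁻¹' Φ.recurrence γ (n - M) (l - M) := by
    ext ω
    have e : ∀ i, Φ.blockWeight (fun k => ω (M + k)) (n - M + 1) i = Φ.blockWeight ω (n + 1) i :=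
      fun i => Φ.blockWeight_congr fun j _ => by
        congr 1
        omega
    simp only [recurrence, mem_preimage, mem_ofPred_eq, e]
    rw [show M + (n - M) = n by omega, show M + (l - M) = l by omega]
    refine and_congr_right fun _ => forall_congr' fun i => imp_congr_right fun _ => ?_
    rw [show M + (n - M + 1 + i) = n + 1 + i by omega, show M + (l - M + 1 + i) = l + 1 + i by omega]
  rw [h]
  exact hshift (Φ.measurableSet_recurrence hθ hK _ _)

/-- Almost every `ω` has recurrences with arbitrarily late sources: this is a tail event, and its
probability is positive. -/
theorem ae_mem_lateRecurrence (Φ : RationalIFS d A) {γ : ℕ → ℝ≥0∞} (hγ1 : ∀ n, γ n ≤ 1)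
    (hγ : ∑' n : ℕ, (n : ℝ≥0∞) * γ n = ∞) {ρ : ℝ≥0∞} (hρ0 : ρ ≠ 0) (hρ1 : ρ < 1)
    (hρ : ∀ a, Φ.weight a ≤ ρ ^ 3) :
    ∀ᵐ ω ∂Φ.bernoulli, ∀ M, ω ∈ Φ.lateRecurrence ρ γ M := by
  obtain ⟨a₀, ha₀⟩ := Finite.exists_min Φ.weight
  have hpos := fun M => Φ.le_bernoulli_lateRecurrence hγ1 hγ hρ0 hρ1 hρ ha₀ M
  let s : ℕ → MeasurableSpace (ℕ → A) := fun k =>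
    MeasurableSpace.comap (fun ω : ℕ → A => ω k) inferInstance
  have hs : ∀ k, s k ≤ MeasurableSpace.pi := fun k => (measurable_pi_apply k).comap_le
  have hm' : ∀ m M, m ≤ M → MeasurableSet[⨆ k ≥ m, s k] (Φ.lateRecurrence ρ γ M) := by
    intro m M h
    refine MeasurableSet.biUnion (to_countable _) fun i hi => ?_
    have := hi.1
    have := hi.2.1
    exact Φ.measurableSet_recurrence_iSup hρ hi.2.2 (by omega) (by omega)
  have hm : ∀ M, MeasurableSet (Φ.lateRecurrence ρ γ M) := fun M =>
    (iSup₂_le fun k _ => hs k) _ (hm' M M le_rfl)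
  have htail : MeasurableSet[limsup s atTop] (⋂ M, Φ.lateRecurrence ρ γ M) := by
    rw [limsup_eq_iInf_iSup_of_nat, MeasurableSpace.measurableSet_iInf]
    intro m
    rw [← (Φ.lateRecurrence_antitone ρ γ).iInter_nat_add m]
    exact MeasurableSet.iInter fun M => hm' m _ (by omega)
  have hind : ProbabilityTheory.iIndep s Φ.bernoulli := by
    have := ProbabilityTheory.iIndepFun_infinitePi
      (P := fun _ : ℕ => ∑ a, ENNReal.ofReal (Φ.prob a) • (Measure.dirac a : Measure A))
      (X := fun _ a => a) fun _ => measurable_id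
    exact this
  have h01 := ProbabilityTheory.measure_zero_or_one_of_measurableSet_limsup_atTop hs hind htail
  have hlim := tendsto_measure_iInter_atTop (μ := Φ.bernoulli)
    (fun M => (hm M).nullMeasurableSet) (Φ.lateRecurrence_antitone ρ γ) ⟨0, measure_ne_top _ _⟩
  have hge : (Φ.weight a₀ * Φ.weight a₀) ^ 2 ≤ 2 * Φ.bernoulli (⋂ M, Φ.lateRecurrence ρ γ M) :=
    ge_of_tendsto' (ENNReal.Tendsto.const_mul hlim (Or.inr (by simp))) hpos
  have h1 : Φ.bernoulli (⋂ M, Φ.lateRecurrence ρ γ M) = 1 := by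
    refine h01.resolve_left fun h0 => ?_
    rw [h0, mul_zero] at hge
    exact absurd (le_antisymm hge zero_le) (by simp [Φ.weight_ne_zero])
  have := (prob_compl_eq_zero_iff (MeasurableSet.iInter hm)).2 h1
  filter_upwards [measure_eq_zero_iff_ae_notMem.1 this] with ω hω
  simpa using hω

end ZeroOne

/-! ### Cylinders and rational points of the self-similar set -/

section Geometry

variable {d : ℕ} {A : Type*}

/-- The contraction ratio `r_{a_1} ⋯ r_{a_n}` of `φ_𝐚`. -/
noncomputable def wordRatio (Φ : RationalIFS d A) {n : ℕ} (a : Fin n → A) : ℝ≥0∞ :=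
  ∏ i, ENNReal.ofReal (Φ.ratio (a i))

theorem wordRatio_ne_zero (Φ : RationalIFS d A) {n : ℕ} (a : Fin n → A) : Φ.wordRatio a ≠ 0 :=
  Finset.prod_ne_zero_iff.2 fun i _ => by simpa using Φ.ratio_pos (a i)

theorem wordRatio_le (Φ : RationalIFS d A) {n : ℕ} (a : Fin n → A) :
    Φ.wordRatio a ≤ (1 / 2) ^ n := by
  refine (Finset.prod_le_pow_card _ _ (1 / 2) fun i _ => ?_).trans_eq (by simp)
  refine (ENNReal.ofReal_le_ofReal (Φ.ratio_le_half _)).trans_eq ?_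
  rw [ENNReal.ofReal_div_of_pos two_pos]
  simp

theorem wordRatio_ne_top (Φ : RationalIFS d A) {n : ℕ} (a : Fin n → A) : Φ.wordRatio a ≠ ∞ :=
  ne_top_of_le_ne_top (ENNReal.pow_ne_top (by simp)) (Φ.wordRatio_le a)

theorem wordMap_succ (Φ : RationalIFS d A) {n : ℕ} (a : Fin (n + 1) → A)
    (x : EuclideanSpace ℝ (Fin d)) :
    Φ.wordMap a x = Φ.map (a 0) (Φ.wordMap (fun i => a i.succ) x) := by
  simp [wordMap, List.ofFn_succ]

theorem edist_wordMap (Φ : RationalIFS d A) {n : ℕ} (a : Fin n → A)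
    (x y : EuclideanSpace ℝ (Fin d)) :
    edist (Φ.wordMap a x) (Φ.wordMap a y) = Φ.wordRatio a * edist x y := by
  induction n with
  | zero => simp [wordMap, wordRatio]
  | succ n ih =>
    rw [wordMap_succ, wordMap_succ, edist_dist, dist_map,
      ENNReal.ofReal_mul (Φ.ratio_pos _).le, ← edist_dist, ih, ← mul_assoc, wordRatio, wordRatio,
      Fin.prod_univ_succ]

theorem cylDiam_eq (Φ : RationalIFS d A) {n : ℕ} (a : Fin n → A) :
    Φ.cylDiam a = Φ.wordRatio a * Metric.ediam Φ.selfSimilarSet := by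
  refine le_antisymm (Metric.ediam_le ?_) ?_
  · rintro _ ⟨x, hx, rfl⟩ _ ⟨y, hy, rfl⟩
    rw [edist_wordMap]
    gcongr
    exact Metric.edist_le_ediam_of_mem hx hy
  · rw [mul_comm, ← ENNReal.le_div_iff_mul_le (Or.inl (Φ.wordRatio_ne_zero a))
      (Or.inl (Φ.wordRatio_ne_top a))]
    refine Metric.ediam_le fun x hx y hy => ?_
    rw [ENNReal.le_div_iff_mul_le (Or.inl (Φ.wordRatio_ne_zero a))
      (Or.inl (Φ.wordRatio_ne_top a)), mul_comm, ← edist_wordMap]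
    exact Metric.edist_le_ediam_of_mem (mem_image_of_mem _ hx) (mem_image_of_mem _ hy)

theorem ediam_selfSimilarSet_ne_top [Finite A] [Nonempty A] (Φ : RationalIFS d A) :
    Metric.ediam Φ.selfSimilarSet ≠ ∞ :=
  Φ.selfSimilarSet_spec.2.1.isBounded.ediam_ne_top

theorem proj_eq_wordMap [Finite A] (Φ : RationalIFS d A) (n : ℕ) (ω : ℕ → A) :
    Φ.proj ω = Φ.wordMap (fun i : Fin n => ω i) (Φ.proj fun k => ω (n + k)) := by
  induction n generalizing ω with
  | zero => simp [wordMap]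
  | succ n ih =>
    rw [wordMap_cons, proj_eq_map, ih fun k => ω (k + 1)]
    simp only [add_right_comm n 1]

theorem edist_proj_le [Finite A] (Φ : RationalIFS d A) {n : ℕ} {ω ω' : ℕ → A}
    (h : ∀ k < n, ω k = ω' k) : edist (Φ.proj ω) (Φ.proj ω') ≤
      Φ.wordRatio (fun i : Fin n => ω i) * Metric.ediam Φ.selfSimilarSet := by
  have e : (fun i : Fin n => ω' i) = fun i : Fin n => ω i := funext fun i => (h i i.2).symm
  rw [Φ.proj_eq_wordMap n ω, Φ.proj_eq_wordMap n ω', e, edist_wordMap]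
  gcongr
  exact Metric.edist_le_ediam_of_mem (mem_range_self _) (mem_range_self _)

theorem map_apply (Φ : RationalIFS d A) (a : A) (x : EuclideanSpace ℝ (Fin d)) (i : Fin d) :
    Φ.map a x i = (Φ.den a : ℝ)⁻¹ * (x i + Φ.num a i) := by
  simp [map, mul_add]

theorem map_injective (Φ : RationalIFS d A) (a : A) : Function.Injective (Φ.map a) := by
  intro x y h
  have := Φ.dist_map a x y
  rw [h, dist_self] at this
  exact dist_eq_zero.1 ((mul_eq_zero.1 this.symm).resolve_left (Φ.ratio_pos a).ne')

/-- `φ_𝐚` is of the form `x ↦ c x + t` with rational coefficients. -/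
theorem exists_rat_wordMap (Φ : RationalIFS d A) {n : ℕ} (a : Fin n → A) :
    ∃ (c : ℚ) (t : Fin d → ℚ), |(c : ℝ)| ≤ (1 / 2) ^ n ∧
      ∀ x i, Φ.wordMap a x i = c * x i + t i := by
  induction n with
  | zero => exact ⟨1, 0, by simp, by simp [wordMap]⟩
  | succ n ih =>
    obtain ⟨c, t, hc, h⟩ := ih fun i => a i.succ
    refine ⟨(Φ.den (a 0) : ℚ)⁻¹ * c, fun i => (Φ.den (a 0) : ℚ)⁻¹ * (t i + Φ.num (a 0) i), ?_,
      fun x i => ?_⟩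
    · push_cast
      rw [abs_mul, abs_inv, pow_succ']
      exact mul_le_mul (Φ.ratio_le_half (a 0)) hc (abs_nonneg _) (by norm_num)
    · rw [wordMap_succ, map_apply, h]
      push_cast
      ring

theorem eventuallyPeriodic_of_le {n : ℕ} (ω : ℕ → A) (l : Fin n) {k : ℕ} (hk : l ≤ k) :
    eventuallyPeriodic (fun i : Fin n => ω i) l k = ω (l + (k - l) % (n - l)) := by
  unfold eventuallyPeriodic
  split_ifs with h
  · rw [Nat.mod_eq_of_lt (by omega), Nat.add_sub_cancel' hk]
  · rfl

theorem eventuallyPeriodic_of_lt {n : ℕ} (a : Fin n → A) (l : Fin n) {k : ℕ} (hk : k < n) :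
    eventuallyPeriodic a l k = a ⟨k, hk⟩ :=
  dif_pos hk

theorem isRationalPoint_proj_eventuallyPeriodic [Finite A] (Φ : RationalIFS d A) {n : ℕ}
    (ω : ℕ → A) (l : Fin n) :
    IsRationalPoint (Φ.proj (eventuallyPeriodic (fun i : Fin n => ω i) l)) := by
  set σ : ℕ → A := fun k => eventuallyPeriodic (fun i : Fin n => ω i) l (l + k) with hσ
  have hper : (fun k => σ (n - l + k)) = σ := by
    funext k
    simp only [hσ]
    rw [eventuallyPeriodic_of_le ω l (by omega), eventuallyPeriodic_of_le ω l (by omega),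
      Nat.add_sub_cancel_left, Nat.add_sub_cancel_left, Nat.add_mod_left]
  have hfix : Φ.proj σ = Φ.wordMap (fun i : Fin (n - l) => σ i) (Φ.proj σ) := by
    conv_lhs => rw [Φ.proj_eq_wordMap (n - l), hper]
  intro i
  obtain ⟨c, t, hc, h⟩ := Φ.exists_rat_wordMap fun i : Fin (n - l) => σ i
  obtain ⟨c', t', -, h'⟩ :=
    Φ.exists_rat_wordMap fun i : Fin l => eventuallyPeriodic (fun i : Fin n => ω i) l i
  have hc1 : (c : ℝ) < 1 := (le_abs_self _).trans_lt
    (hc.trans_lt (pow_lt_one₀ (by norm_num) (by norm_num) (by omega)))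
  have hz : Φ.proj σ i = t i / (1 - c) := by
    rw [eq_div_iff (by linarith)]
    have := h (Φ.proj σ) i
    rw [← hfix] at this
    linarith
  refine ⟨c' * (t i / (1 - c)) + t' i, ?_⟩
  rw [Φ.proj_eq_wordMap l, h', hz]
  push_cast
  rfl

theorem countable_setOf_isRationalPoint :
    {y : EuclideanSpace ℝ (Fin d) | IsRationalPoint y}.Countable := by
  refine (countable_range fun (c : Fin d → ℚ) =>
    (WithLp.toLp 2 fun i => (c i : ℝ) : EuclideanSpace ℝ (Fin d))).mono fun y hy => ?_
  choose c hc using hy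
  refine ⟨c, ?_⟩
  ext i
  exact (hc i).symm

end Geometry

/-! ### The convergence part -/

theorem hausdorffMeasure_wellApproximable_eq_zero {d : ℕ} {A : Type*} [Fintype A] [Nonempty A]
    (Φ : RationalIFS d A) (g : ℕ → ℝ≥0) {s : ℝ} (hs : 0 ≤ s) (hsum : Φ.volumeSum g s < ∞) :
    Measure.hausdorffMeasure s (Φ.wellApproximable g) = 0 := by
  classical
  obtain rfl | hs := hs.eq_or_lt
  · -- as `0 ^ 0 = 1`, the sum diverges for `s = 0`
    refine absurd hsum (not_lt.2 (top_le_iff.2 ?_))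
    have hinf : Infinite {n : ℕ // 1 ≤ n} := (Set.infinite_coe_iff.2 (Set.Ici_infinite 1))
    rw [← top_le_iff, ← ENNReal.tsum_const_eq_top_of_ne_zero (α := {n : ℕ // 1 ≤ n}) one_ne_zero]
    refine ENNReal.tsum_le_tsum fun n => ?_
    obtain ⟨a⟩ := (inferInstance : Nonempty (Fin (n : ℕ) → A))
    refine le_trans ?_ (Finset.single_le_sum (fun _ _ => zero_le) (Finset.mem_univ a))
    rw [ENNReal.rpow_zero, mul_one]
    exact_mod_cast n.2
  let ι := Σ n : ℕ, (Fin n → A) × Fin n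
  let y : ι → EuclideanSpace ℝ (Fin d) := fun i => Φ.proj (eventuallyPeriodic i.2.1 i.2.2)
  let R : ι → ℝ≥0∞ := fun i => Φ.cylDiam i.2.1 * (g i.1 : ℝ≥0∞)
  have hR : ∑' i, R i ^ s ≠ ∞ := by
    refine ne_top_of_le_ne_top hsum.ne (le_of_eq ?_)
    rw [ENNReal.tsum_sigma', volumeSum]
    let f : ℕ → ℝ≥0∞ := fun n =>
      ∑ a : Fin n → A, (n : ℝ≥0∞) * (Φ.cylDiam a * (g n : ℝ≥0∞)) ^ s
    have hf : ∑' n : {n : ℕ // 1 ≤ n}, f n = ∑' n, f n :=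
      tsum_subtype_eq_of_support_subset (s := {n : ℕ | 1 ≤ n}) fun n hn => by
        refine Nat.one_le_iff_ne_zero.2 fun h => hn ?_
        subst h
        simp [f]
    refine Eq.trans (tsum_congr fun n => ?_) hf.symm
    rw [tsum_fintype, Fintype.sum_prod_type]
    refine Finset.sum_congr rfl fun a _ => ?_
    simp [R]
  let t : Finset ι → ι → Set (EuclideanSpace ℝ (Fin d)) := fun F i =>
    if i ∈ F then ∅ else Metric.eball (y i) (R i)
  have htail := ENNReal.tendsto_tsum_compl_atTop_zero hR
  have htd : ∀ F i, Metric.ediam (t F i) ≤ if i ∈ F then 0 else 2 * R i := fun F i => by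
    simp only [t]
    split_ifs
    · simp
    · exact Metric.ediam_eball_le
  have hcov : ∀ F, Φ.wellApproximable g ⊆ ⋃ i, t F i := by
    rintro F x ⟨-, hx⟩
    obtain ⟨z, ⟨-, -, hz⟩, hzF⟩ := hx.exists_notMem_finset (F.image y)
    simp only [approxRadius, lt_iSup_iff] at hz
    obtain ⟨n, a, l, hy, hz⟩ := hz
    have hF : (⟨n, a, l⟩ : ι) ∉ F := fun h => hzF (Finset.mem_image.2 ⟨_, h, hy⟩)
    refine mem_iUnion.2 ⟨⟨n, a, l⟩, ?_⟩
    simp only [t, if_neg hF]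
    rw [Metric.mem_eball]
    simpa only [y, R, hy] using hz
  have hr : Tendsto (fun F : Finset ι => 2 * (∑' i : {i // i ∉ F}, R i ^ s) ^ s⁻¹) atTop
      (𝓝 0) := by
    have h := ENNReal.Tendsto.const_mul (a := 2)
      ((ENNReal.continuous_rpow_const (y := s⁻¹)).continuousAt.tendsto.comp htail)
      (Or.inr (by simp))
    simpa [ENNReal.zero_rpow_of_pos (inv_pos.2 hs)] using h
  have hle := Measure.hausdorffMeasure_le_liminf_tsum s (Φ.wellApproximable g) _ hr t
    (Eventually.of_forall fun F i => (htd F i).trans ?_) (Eventually.of_forall hcov)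
  · have hlim : Tendsto (fun F : Finset ι => 2 ^ s * ∑' i : {i // i ∉ F}, R i ^ s) atTop (𝓝 0) := by
      simpa using ENNReal.Tendsto.const_mul (a := 2 ^ s) htail
        (Or.inr (ENNReal.rpow_ne_top_of_nonneg hs.le (by simp)))
    refine le_antisymm (hle.trans ?_) zero_le
    rw [← hlim.liminf_eq]
    refine liminf_le_liminf (Eventually.of_forall fun F => ?_)
    have h1 : ∑' i : {i // i ∉ F}, R i ^ s = ∑' i, {i | i ∉ F}.indicator (fun i => R i ^ s) i :=
      tsum_subtype {i | i ∉ F} fun i => R i ^ s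
    rw [h1, ← ENNReal.tsum_mul_left]
    refine ENNReal.tsum_le_tsum fun i => ?_
    refine (ENNReal.rpow_le_rpow (htd F i) hs.le).trans ?_
    by_cases hi : i ∈ F
    · simp [hi, ENNReal.zero_rpow_of_pos hs]
    · simp [hi, ENNReal.mul_rpow_of_nonneg _ _ hs.le]
  · split_ifs with hi
    · exact zero_le
    · gcongr
      rw [ENNReal.le_rpow_inv_iff hs]
      exact ENNReal.le_tsum (f := fun i : {i // i ∉ F} => R i ^ s) ⟨i, hi⟩

/-! ### The self-similar measure has no atoms -/

section NoAtoms

variable {d : ℕ} {A : Type*} [Fintype A] [Nonempty A] [MeasurableSpace A]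
  [DiscreteMeasurableSpace A]

theorem bernoulli_proj_eq (Φ : RationalIFS d A) (y : EuclideanSpace ℝ (Fin d)) :
    Φ.bernoulli {ω | Φ.proj ω = y} =
      ∑ a, Φ.weight a * Φ.bernoulli {ω | Φ.map a (Φ.proj ω) = y} := by
  have hm : MeasurableSet {ω | Φ.proj ω = y} := Φ.measurable_proj (measurableSet_singleton y)
  conv_lhs => rw [bernoulli_eq]
  rw [Measure.finsetSum_apply]
  refine Finset.sum_congr rfl fun a _ => ?_
  rw [Measure.smul_apply, Measure.map_apply (measurable_consSeq a) hm, smul_eq_mul, weight]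
  congr 2
  ext ω
  simp only [mem_preimage, mem_ofPred_eq]
  rw [Φ.proj_eq_map (consSeq a ω)]
  rfl

/-- A point outside the cylinder `X_𝐚` loses at least the proportion `p_𝐚` of the largest mass of
an atom. -/
theorem bernoulli_proj_add_le (Φ : RationalIFS d A) {n : ℕ} (u : Fin n → A)
    {y : EuclideanSpace ℝ (Fin d)} (hy : y ∉ Φ.wordMap u '' Φ.selfSimilarSet) {m : ℝ≥0∞}
    (hm : ∀ z, Φ.bernoulli {ω | Φ.proj ω = z} ≤ m) :
    Φ.bernoulli {ω | Φ.proj ω = y} + (∏ i, Φ.weight (u i)) * m ≤ m := by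
  classical
  induction n generalizing y with
  | zero =>
    have : {ω | Φ.proj ω = y} = ∅ := eq_empty_of_forall_notMem fun ω hω =>
      hy ⟨y, ⟨ω, hω⟩, by simp [wordMap]⟩
    simp [this]
  | succ n ih =>
    have hstep : ∀ a, {ω | Φ.map a (Φ.proj ω) = y} = ∅ ∨ ∃ z, Φ.map a z = y ∧
        {ω | Φ.map a (Φ.proj ω) = y} = {ω | Φ.proj ω = z} := by
      intro a
      rcases eq_empty_or_nonempty {ω | Φ.map a (Φ.proj ω) = y} with h | ⟨ω₀, h⟩
      · exact Or.inl h
      · refine Or.inr ⟨_, h, ?_⟩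
        ext ω
        exact ⟨fun hω => Φ.map_injective a (Eq.trans hω (Eq.symm h)),
          fun hω => (congrArg (Φ.map a) hω).trans h⟩
    have hle : ∀ a, Φ.bernoulli {ω | Φ.map a (Φ.proj ω) = y} +
        (if a = u 0 then (∏ i : Fin n, Φ.weight (u i.succ)) * m else 0) ≤ m := by
      intro a
      split_ifs with ha
      · subst ha
        rcases hstep (u 0) with h | ⟨z, hz, h⟩
        · rw [h, measure_empty, zero_add]
          exact mul_le_of_le_one_left' (Finset.prod_le_one' fun i _ => Φ.weight_le_one _)
        · rw [h]
          refine ih (fun i => u i.succ) fun hzu => hy ?_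
          obtain ⟨x, hx, rfl⟩ := hzu
          exact ⟨x, hx, by rw [wordMap_succ, hz]⟩
      · rcases hstep a with h | ⟨z, hz, h⟩
        · simp [h]
        · rw [h, add_zero]
          exact hm z
    calc Φ.bernoulli {ω | Φ.proj ω = y} + (∏ i, Φ.weight (u i)) * m
        = ∑ a, Φ.weight a * (Φ.bernoulli {ω | Φ.map a (Φ.proj ω) = y} +
          (if a = u 0 then (∏ i : Fin n, Φ.weight (u i.succ)) * m else 0)) := by
          rw [bernoulli_proj_eq, Fin.prod_univ_succ]
          simp only [mul_add, Finset.sum_add_distrib, mul_ite, mul_zero, Finset.sum_ite_eq',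
            Finset.mem_univ, if_true, mul_assoc]
      _ ≤ ∑ a, Φ.weight a * m := by
          gcongr with a
          exact hle a
      _ = m := by rw [← Finset.sum_mul, Φ.sum_weight, one_mul]

theorem bernoulli_proj_eq_zero (Φ : RationalIFS d A) (hX : Metric.ediam Φ.selfSimilarSet ≠ 0)
    (y : EuclideanSpace ℝ (Fin d)) : Φ.bernoulli {ω | Φ.proj ω = y} = 0 := by
  have hXt := Φ.ediam_selfSimilarSet_ne_top
  obtain ⟨ω, ω', hne⟩ : ∃ ω ω', Φ.proj ω ≠ Φ.proj ω' := by
    by_contra! h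
    refine hX (Metric.ediam_eq_zero_iff.2 ?_)
    rintro _ ⟨ω, rfl⟩ _ ⟨ω', rfl⟩
    exact h ω ω'
  have hlim : Tendsto (fun n : ℕ => 2 * ((1 / 2 : ℝ≥0∞) ^ n * Metric.ediam Φ.selfSimilarSet)) atTop
      (𝓝 0) := by
    have h := ENNReal.tendsto_pow_atTop_nhds_zero_of_lt_one (r := 1 / 2) (by simp)
    simpa using ENNReal.Tendsto.const_mul (a := 2)
      (ENNReal.Tendsto.mul_const h (Or.inr hXt)) (Or.inr (by simp))
  obtain ⟨n, hn⟩ := (hlim.eventually (gt_mem_nhds (edist_pos.2 hne))).exists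
  let u : (ℕ → A) → Fin n → A := fun ω i => ω i
  have hmem : ∀ ω z, z ∈ Φ.wordMap (u ω) '' Φ.selfSimilarSet →
      edist (Φ.proj ω) z ≤ (1 / 2) ^ n * Metric.ediam Φ.selfSimilarSet := by
    rintro ω _ ⟨x, hx, rfl⟩
    rw [Φ.proj_eq_wordMap n ω, edist_wordMap]
    exact mul_le_mul' (Φ.wordRatio_le _) (Metric.edist_le_ediam_of_mem (mem_range_self _) hx)
  set m := ⨆ z, Φ.bernoulli {ω | Φ.proj ω = z} with hmdef
  have hm : ∀ z, Φ.bernoulli {ω | Φ.proj ω = z} ≤ m := le_iSup fun z =>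
    Φ.bernoulli {ω | Φ.proj ω = z}
  have hmt : m ≠ ∞ := ne_top_of_le_ne_top ENNReal.one_ne_top (iSup_le fun z => prob_le_one)
  set c := min (∏ i, Φ.weight (u ω i)) (∏ i, Φ.weight (u ω' i)) with hc
  have hc0 : c ≠ 0 := by
    have h : ∀ ω, 0 < ∏ i, Φ.weight (u ω i) := fun ω =>
      pos_iff_ne_zero.2 (Finset.prod_ne_zero_iff.2 fun i _ => Φ.weight_ne_zero _)
    exact (lt_min (h ω) (h ω')).ne'
  have key : ∀ z, Φ.bernoulli {ω | Φ.proj ω = z} + c * m ≤ m := by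
    intro z
    by_cases h : z ∈ Φ.wordMap (u ω) '' Φ.selfSimilarSet
    · have h' : z ∉ Φ.wordMap (u ω') '' Φ.selfSimilarSet := fun h' => by
        refine hn.not_ge ((edist_triangle_right _ _ z).trans ?_)
        rw [two_mul]
        exact add_le_add (hmem ω z h) (hmem ω' z h')
      refine le_trans ?_ (Φ.bernoulli_proj_add_le (u ω') h' hm)
      gcongr
      exact min_le_right _ _
    · refine le_trans ?_ (Φ.bernoulli_proj_add_le (u ω) h hm)
      gcongr
      exact min_le_left _ _
  have hm0 : m = 0 := by
    by_contra h0
    have hcm : c * m ≠ ∞ := ne_top_of_le_ne_top hmt (le_add_self.trans (key y))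
    have : m ≤ m - c * m := iSup_le fun z => ENNReal.le_sub_of_add_le_right hcm (key z)
    exact (ENNReal.sub_lt_self hmt h0 (mul_ne_zero hc0 h0)).not_ge this
  exact le_antisymm ((hm y).trans_eq hm0) zero_le

end NoAtoms

/-! ### The divergence part -/

section Divergence

variable {d : ℕ} {A : Type*} [Fintype A] [Nonempty A]

theorem simDim_pos [Nontrivial A] (Φ : RationalIFS d A) : 0 < Φ.simDim := by
  by_contra! h
  have h1 := Φ.simDim_spec
  have h2 : ∑ a : A, (1 : ℝ) ≤ ∑ a, Φ.ratio a ^ Φ.simDim := Finset.sum_le_sum fun a _ =>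
    Real.one_le_rpow_of_pos_of_le_one_of_nonpos (Φ.ratio_pos a)
      ((Φ.ratio_le_half a).trans (by norm_num)) h
  rw [h1] at h2
  have h3 : 1 < Fintype.card A := Fintype.one_lt_card
  have h4 : Fintype.card A ≤ 1 := by simpa using h2
  omega

theorem nontrivial_of_entropy_lt (Φ : RationalIFS d A)
    (h : Φ.entropy < -2 * Real.log (∑ a, Φ.prob a ^ 2)) : Nontrivial A := by
  by_contra hA
  rw [not_nontrivial_iff_subsingleton] at hA
  obtain ⟨a⟩ := ‹Nonempty A›
  have : Unique A := ⟨⟨a⟩, fun b => Subsingleton.elim b a⟩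
  have h1 : Φ.prob default = 1 := by
    have := Φ.simDim_spec
    rwa [Fintype.sum_unique] at this
  simp [entropy, h1] at h

theorem volumeSum_simDim (Φ : RationalIFS d A) (g : ℕ → ℝ≥0) (hs : 0 ≤ Φ.simDim) :
    Φ.volumeSum g Φ.simDim = Metric.ediam Φ.selfSimilarSet ^ Φ.simDim *
      ∑' n : ℕ, ((n + 1 : ℕ) : ℝ≥0∞) * (g (n + 1) : ℝ≥0∞) ^ Φ.simDim := by
  have h : ∀ n : ℕ, ∑ a : Fin n → A, (n : ℝ≥0∞) * (Φ.cylDiam a * (g n : ℝ≥0∞)) ^ Φ.simDim =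
      Metric.ediam Φ.selfSimilarSet ^ Φ.simDim * ((n : ℝ≥0∞) * (g n : ℝ≥0∞) ^ Φ.simDim) := by
    intro n
    have h1 : ∑ a : Fin n → A, Φ.wordRatio a ^ Φ.simDim = 1 := by
      have h2 : ∀ a : Fin n → A, Φ.wordRatio a ^ Φ.simDim = ∏ i, Φ.weight (a i) := fun a => by
        rw [wordRatio, ← ENNReal.prod_rpow_of_nonneg hs]
        exact Finset.prod_congr rfl fun i _ => (Φ.weight_eq_rpow _).symm
      simp only [h2]
      rw [← Fintype.prod_sum (f := fun (_ : Fin n) a => Φ.weight a)]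
      simp [Φ.sum_weight]
    calc ∑ a : Fin n → A, (n : ℝ≥0∞) * (Φ.cylDiam a * (g n : ℝ≥0∞)) ^ Φ.simDim
        = ∑ a : Fin n → A, Φ.wordRatio a ^ Φ.simDim * (Metric.ediam Φ.selfSimilarSet ^ Φ.simDim *
            ((n : ℝ≥0∞) * (g n : ℝ≥0∞) ^ Φ.simDim)) := by
          refine Finset.sum_congr rfl fun a _ => ?_
          rw [cylDiam_eq, ENNReal.mul_rpow_of_nonneg _ _ hs, ENNReal.mul_rpow_of_nonneg _ _ hs]
          ring
      _ = _ := by rw [← Finset.sum_mul, h1, one_mul]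
  rw [volumeSum]
  simp only [h]
  rw [ENNReal.tsum_mul_left]
  congr 1
  exact tsum_pnat_eq_tsum_succ (f := fun n : ℕ => (n : ℝ≥0∞) * (g n : ℝ≥0∞) ^ Φ.simDim)

/-- A recurrence with weight less than `g(n+1)^{dim_S}` yields an eventually periodic point that
shares a cylinder of small diameter with `π(ω)`. -/
theorem exists_rational_near (Φ : RationalIFS d A) (hs : 0 < Φ.simDim)
    (hX : Metric.ediam Φ.selfSimilarSet ≠ 0) {g : ℕ → ℝ≥0} {θ γ : ℝ≥0∞}
    (hθ : ∀ a, Φ.weight a ≤ θ) {K : ℕ} (hK : θ ^ K < γ) {n l : ℕ} (hl : l < n)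
    (hγ : γ ≤ (g (n + 1) : ℝ≥0∞) ^ Φ.simDim) {ω : ℕ → A} (hω : ω ∈ Φ.recurrence γ n l) :
    ∃ y ∈ Φ.selfSimilarSet, IsRationalPoint y ∧ edist (Φ.proj ω) y < Φ.approxRadius g y ∧
      edist (Φ.proj ω) y ≤ (1 / 2) ^ n * Metric.ediam Φ.selfSimilarSet := by
  classical
  have hXt := Φ.ediam_selfSimilarSet_ne_top
  have hex : ∃ k, Φ.blockWeight ω (n + 1) k < γ := ⟨K, (Φ.blockWeight_le_pow hθ ω _ K).trans_lt hK⟩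
  set k := Nat.find hex with hk
  have hk1 : Φ.blockWeight ω (n + 1) k < γ := Nat.find_spec hex
  have hk2 : ∀ i < k, ω (n + 1 + i) = ω (l + 1 + i) := fun i hi =>
    hω.2 i (not_lt.1 (Nat.find_min hex hi))
  let l' : Fin (n + 1) := ⟨l + 1, by omega⟩
  set η : ℕ → A := eventuallyPeriodic (fun i : Fin (n + 1) => ω i) l' with hη
  have hagree : ∀ q, q < n + 1 + k → ω q = η q := by
    intro q
    induction q using Nat.strong_induction_on with
    | _ q ih =>
      intro hq
      rcases lt_or_ge q (n + 1) with h | h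
      · rw [hη, eventuallyPeriodic_of_lt _ _ h]
      · obtain ⟨i, rfl⟩ := Nat.exists_eq_add_of_le h
        rw [hk2 i (by omega), ih (l + 1 + i) (by omega) (by omega), hη,
          eventuallyPeriodic_of_le ω l' (show l + 1 ≤ l + 1 + i by omega),
          eventuallyPeriodic_of_le ω l' (show l + 1 ≤ n + 1 + i by omega),
          show n + 1 + i - (l' : ℕ) = (n + 1 - (l' : ℕ)) + i by simp only [l']; omega,
          Nat.add_mod_left, show l + 1 + i - (l' : ℕ) = i by simp only [l']; omega]
  have hdist := Φ.edist_proj_le hagree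
  refine ⟨Φ.proj η, mem_range_self _, Φ.isRationalPoint_proj_eventuallyPeriodic ω l', ?_, ?_⟩
  · refine lt_of_lt_of_le ?_ (le_iSup₂_of_le (n + 1) (fun i => ω i)
      (le_iSup₂_of_le l' rfl le_rfl))
    refine hdist.trans_lt ?_
    set b : ℝ≥0∞ := ∏ j ∈ Finset.range k, ENNReal.ofReal (Φ.ratio (ω (n + 1 + j))) with hb
    have hbg : b < g (n + 1) := by
      rw [← ENNReal.rpow_lt_rpow_iff hs]
      refine lt_of_eq_of_lt ?_ (hk1.trans_le hγ)
      rw [hb, ← ENNReal.prod_rpow_of_nonneg hs.le]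
      exact Finset.prod_congr rfl fun i _ => (Φ.weight_eq_rpow _).symm
    have hsplit : Φ.wordRatio (fun i : Fin (n + 1 + k) => ω i) =
        Φ.wordRatio (fun i : Fin (n + 1) => ω i) * b := by
      rw [wordRatio, wordRatio,
        Fin.prod_univ_eq_prod_range (fun j => ENNReal.ofReal (Φ.ratio (ω j))) (n + 1 + k),
        Fin.prod_univ_eq_prod_range (fun j => ENNReal.ofReal (Φ.ratio (ω j))) (n + 1),
        Finset.prod_range_add]
    rw [hsplit, cylDiam_eq, mul_right_comm]
    exact ENNReal.mul_lt_mul_right (mul_ne_zero (Φ.wordRatio_ne_zero _) hX)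
      (ENNReal.mul_ne_top (Φ.wordRatio_ne_top _) hXt) hbg
  · refine hdist.trans ?_
    gcongr
    exact (Φ.wordRatio_le _).trans (pow_le_pow_right_of_le_one' (by simp) (by omega))

theorem selfSimilarMeasure_wellApproximable_eq_one [Nontrivial A] [MeasurableSpace A]
    [DiscreteMeasurableSpace A] (Φ : RationalIFS d A) (g : ℕ → ℝ≥0)
    (hsum : Φ.volumeSum g Φ.simDim = ∞) :
    Φ.selfSimilarMeasure (Φ.wellApproximable g) = 1 := by
  have hs := Φ.simDim_pos
  rw [Φ.volumeSum_simDim g hs.le] at hsum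
  have hXt := Φ.ediam_selfSimilarSet_ne_top
  have hX : Metric.ediam Φ.selfSimilarSet ≠ 0 := by
    intro h
    rw [h, ENNReal.zero_rpow_of_pos hs, zero_mul] at hsum
    exact ENNReal.zero_ne_top hsum
  have hdiv : ∑' n : ℕ, ((n + 1 : ℕ) : ℝ≥0∞) * (g (n + 1) : ℝ≥0∞) ^ Φ.simDim = ∞ := by
    by_contra h
    exact ENNReal.mul_ne_top (ENNReal.rpow_ne_top_of_nonneg hs.le hXt) h hsum
  set γ : ℕ → ℝ≥0∞ := fun n => min ((g (n + 1) : ℝ≥0∞) ^ Φ.simDim) 1 with hγ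
  have hγsum := tsum_mul_min_one_eq_top (f := fun n => (g (n + 1) : ℝ≥0∞) ^ Φ.simDim)
    (fun n => ENNReal.rpow_ne_top_of_nonneg hs.le ENNReal.coe_ne_top) hdiv
  -- `ρ` is chosen with `ρ ^ 3 = (1 / 2) ^ dim_S`, a bound for all weights
  set ρ : ℝ≥0∞ := (1 / 2) ^ (Φ.simDim / 3) with hρdef
  have hρ0 : ρ ≠ 0 := by simp [hρdef, ENNReal.rpow_eq_zero_iff]
  have hρ1 : ρ < 1 := ENNReal.rpow_lt_one (by simp) (by positivity)
  have hρ : ∀ a, Φ.weight a ≤ ρ ^ 3 := fun a => by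
    have e : ρ ^ 3 = (1 / 2) ^ Φ.simDim := by
      rw [hρdef, ← ENNReal.rpow_natCast, ← ENNReal.rpow_mul]
      congr 1
      push_cast
      ring
    rw [e, weight_eq_rpow]
    refine ENNReal.rpow_le_rpow ((ENNReal.ofReal_le_ofReal (Φ.ratio_le_half _)).trans_eq ?_) hs.le
    rw [ENNReal.ofReal_div_of_pos two_pos]
    simp
  have hrec := Φ.ae_mem_lateRecurrence (γ := γ) (fun n => min_le_right _ _) hγsum hρ0 hρ1 hρ
  have hirr : ∀ᵐ ω ∂Φ.bernoulli, ¬ IsRationalPoint (Φ.proj ω) := by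
    have h : ∀ᵐ ω ∂Φ.bernoulli,
        ∀ y ∈ {y : EuclideanSpace ℝ (Fin d) | IsRationalPoint y}, Φ.proj ω ≠ y := by
      rw [ae_ball_iff countable_setOf_isRationalPoint]
      intro y _
      rw [ae_iff]
      simpa using Φ.bernoulli_proj_eq_zero hX y
    filter_upwards [h] with ω hω hrat using hω _ hrat rfl
  have hW : ∀ᵐ ω ∂Φ.bernoulli, ω ∈ Φ.proj ⁻¹' Φ.wellApproximable g := by
    filter_upwards [hrec, hirr] with ω hω hirr
    refine ⟨mem_range_self _, fun hfin => ?_⟩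
    -- finitely many rational points keep a positive distance from the irrational point `π(ω)`
    obtain ⟨ε, hε, hεle⟩ : ∃ ε : ℝ≥0∞, 0 < ε ∧ ∀ y ∈ {y ∈ Φ.selfSimilarSet | IsRationalPoint y ∧
        edist (Φ.proj ω) y < Φ.approxRadius g y}, ε ≤ edist (Φ.proj ω) y := by
      rcases Set.eq_empty_or_nonempty {y ∈ Φ.selfSimilarSet | IsRationalPoint y ∧
        edist (Φ.proj ω) y < Φ.approxRadius g y} with h | h
      · exact ⟨1, one_pos, by simp [h]⟩
      · obtain ⟨y₀, hy₀, hmin⟩ := Set.exists_min_image _ (edist (Φ.proj ω)) hfin h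
        refine ⟨_, edist_pos.2 fun h => hirr ?_, hmin⟩
        rw [h]
        exact hy₀.2.1
    have hlim : Tendsto (fun n : ℕ => (1 / 2 : ℝ≥0∞) ^ n * Metric.ediam Φ.selfSimilarSet) atTop
        (𝓝 0) := by
      simpa using ENNReal.Tendsto.mul_const
        (ENNReal.tendsto_pow_atTop_nhds_zero_of_lt_one (r := 1 / 2) (by simp)) (Or.inr hXt)
    obtain ⟨M, hM⟩ := eventually_atTop.1 (hlim.eventually (gt_mem_nhds hε))
    obtain ⟨⟨n, l⟩, ⟨h1, h2, h3⟩, hnl⟩ := mem_iUnion₂.1 (hω M)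
    simp only at h1 h2 h3 hnl
    obtain ⟨y, hyX, hyQ, hy1, hy2⟩ :=
      Φ.exists_rational_near hs hX hρ h3 h2 (min_le_left _ _) hnl
    exact (hεle y ⟨hyX, hyQ, hy1⟩).not_gt (hy2.trans_lt (hM n (by omega)))
  have hprob : IsProbabilityMeasure Φ.selfSimilarMeasure := Φ.selfSimilarMeasure_spec.1
  refine le_antisymm prob_le_one ?_
  calc (1 : ℝ≥0∞) = Φ.bernoulli (Φ.proj ⁻¹' Φ.wellApproximable g) :=
        ((measure_congr (eventuallyEq_univ.2 hW)).trans measure_univ).symm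
    _ ≤ _ := Measure.le_map_apply Φ.measurable_proj.aemeasurable _

end Divergence

end RationalIFS

theorem theorem2p5 {d : ℕ} {A : Type*} [Fintype A] [Nonempty A]
    [MeasurableSpace A] [DiscreteMeasurableSpace A]
    (Φ : RationalIFS d A) (g : ℕ → ℝ≥0) :
    (∀ s : ℝ, 0 ≤ s → Φ.volumeSum g s < ∞ →
      Measure.hausdorffMeasure s (Φ.wellApproximable g) = 0) ∧
    (AntitoneOn g (Set.Ici 1) →
      Φ.entropy < -2 * Real.log (∑ a, Φ.prob a ^ 2) →
      Φ.volumeSum g Φ.simDim = ∞ →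
      Φ.selfSimilarMeasure (Φ.wellApproximable g) = 1) := by
  refine ⟨fun s hs hsum => Φ.hausdorffMeasure_wellApproximable_eq_zero g hs hsum,
    fun _ hent hsum => ?_⟩
  have := Φ.nontrivial_of_entropy_lt hent
  exact Φ.selfSimilarMeasure_wellApproximable_eq_one g hsum
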